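/- Let $\mathbb{K}$ be a field of characteristic zero. For a vector space $R$, let $S^c(R)=\bigoplus_{n\ge 0}S^n(R)$, where $S^n(R)=(R^{\otimes n})_{S_n}$, be the symmetric module with its counital cocommutative coproduct $\Delta(v_1\cdots v_n)=\sum_{I\sqcup J=\{1,\dots,n\}} v_I\otimes v_J$. A cofree-cocommutative combinatorial Hopf algebra (CHA) is a Hopf algebra $\mathcal H$ over $\mathbb{K}$ together with a vector space $R$ and a prescribed isomorphism of coalgebras $\mathcal H\cong S^c(R)$; equivalently, a vector space $R$ with a product $*$ on $S^c(R)$ making $(S^c(R),*,\Delta)$ a Hopf algebra. A morphism of such objects is a linear map $\varphi:R\to R'$ whose extension $S^c(\varphi):S^c(R)\to S^c(R')$, $v_1\cdots v_n\mapsto\varphi(v_1)\cdots\varphi(v_n)$, is a morphism of Hopf algebras. Put $\mathcal H^n:=S^n(R)$. The CHA is right-sided if for every integer $q\ge 0$ the subspace $\bigoplus_{n\ge q}\mathcal H^n$ is a right ideal of $\mathcal H$. Let $M_{11}:R\otimes R\to R$ send $x\otimes y$ to the component of $x*y$ in $S^1(R)=R$. A pre-Lie algebra is a vector space with a bilinear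 product $\{-,-\}$ such that $\{\{x,y\},z\}-\{x,\{y,z\}\}=\{\{x,z\},y\}-\{x,\{z,y\}\}$; morphisms of pre-Lie algebras are the linear maps that preserve the products. **Theorem.** For every cofree-cocommutative right-sided CHA $\mathcal H\cong S^c(R)$ the operation $M_{11}$ is a pre-Lie product on $R$, and the functor $(\mathcal H\cong S^c(R))\mapsto(R,M_{11})$, $\varphi\mapsto\varphi$, is an equivalence from the category of cofree-cocommutative right-sided CHAs to the category of pre-Lie algebras. Moreover $R\subset\mathcal H$ is exactly the space of primitive elements of $\mathcal H$, and for $x,y\in R$ the Lie bracket of primitives is the antisymmetrization of $M_{11}$: $x*y-y*x=M_{11}(x;y)-M_{11}(y;x)$. -/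

import Mathlib

open CategoryTheory
open scoped TensorProduct

universe u v

noncomputable section

namespace SymCoalg

variable {K : Type u} [Field K]
variable {V W X : Type v} [AddCommGroup V] [Module K V] [AddCommGroup W] [Module K W]
  [AddCommGroup X] [Module K X]

/-- The homogeneous component `Sⁿ(V)` of the symmetric module `S(V)`: the span of the `n`-fold
products of elements of `V`. -/
def component (K : Type u) [Field K] (V : Type v) [AddCommGroup V] [Module K V] (n : ℕ) :
    Submodule K (SymmetricAlgebra K V) :=
  (LinearMap.range (SymmetricAlgebra.ι K V)) ^ n

/-- The extension `Sᶜ(φ) : Sᶜ(V) → Sᶜ(W)`, `v₁ ⋯ vₙ ↦ φ(v₁) ⋯ φ(vₙ)`, of a linear map `φ`. It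
preserves `1` and the coalgebra structure (and also the polynomial product). -/
def map (φ : V →ₗ[K] W) : SymmetricAlgebra K V →ₐc[K] SymmetricAlgebra K W :=
  BialgHom.ofAlgHom (SymmetricAlgebra.lift (SymmetricAlgebra.ι K W ∘ₗ φ))
    (by
      ext x
      simp [SymmetricAlgebra.algebraMapInv_ι])
    (by
      ext x
      simp)

@[simp]
theorem map_ι (φ : V →ₗ[K] W) (x : V) :
    map φ (SymmetricAlgebra.ι K V x) = SymmetricAlgebra.ι K W (φ x) :=
  SymmetricAlgebra.lift_ι_apply _ x

theorem map_toAlgHom (φ : V →ₗ[K] W) :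
    (map φ : SymmetricAlgebra K V →ₐ[K] SymmetricAlgebra K W)
      = SymmetricAlgebra.lift (SymmetricAlgebra.ι K W ∘ₗ φ) := by
  ext x
  simp

theorem map_id (a : SymmetricAlgebra K V) : map (LinearMap.id : V →ₗ[K] V) a = a := by
  have h : (map (LinearMap.id : V →ₗ[K] V) : SymmetricAlgebra K V →ₐ[K] SymmetricAlgebra K V)
      = AlgHom.id K _ := by
    ext x
    simp
  exact DFunLike.congr_fun h a

theorem map_comp (φ : V →ₗ[K] W) (ψ : W →ₗ[K] X) (a : SymmetricAlgebra K V) :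
    map (ψ ∘ₗ φ) a = map ψ (map φ a) := by
  have h : (map (ψ ∘ₗ φ) : SymmetricAlgebra K V →ₐ[K] SymmetricAlgebra K X)
      = (map ψ : SymmetricAlgebra K W →ₐ[K] SymmetricAlgebra K X).comp
          (map φ : SymmetricAlgebra K V →ₐ[K] SymmetricAlgebra K W) := by
    ext x
    simp
  exact DFunLike.congr_fun h a

/-- The quotient of `S(V)` by its components of degree at least `2`, as the square-zero extension
of `K` by `V`. -/
def toSqZero [Module Kᵐᵒᵖ V] [IsCentralScalar K V] :
    SymmetricAlgebra K V →ₐ[K] TrivSqZeroExt K V :=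
  SymmetricAlgebra.lift (TrivSqZeroExt.inrHom K V)

@[simp]
theorem toSqZero_ι [Module Kᵐᵒᵖ V] [IsCentralScalar K V] (x : V) :
    toSqZero (SymmetricAlgebra.ι K V x) = TrivSqZeroExt.inr x :=
  SymmetricAlgebra.lift_ι_apply _ x

/-- The projection `S(V) → S¹(V) = V` that kills all the components `Sⁿ(V)`, `n ≠ 1`
(see `proj_ι` and `proj_component`). -/
def proj (K : Type u) [Field K] (V : Type v) [AddCommGroup V] [Module K V] :
    SymmetricAlgebra K V →ₗ[K] V := by
  letI : Module Kᵐᵒᵖ V := Module.compHom _ ((RingHom.id K).fromOpposite mul_comm)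
  haveI : IsCentralScalar K V := ⟨fun r m => rfl⟩
  exact (TrivSqZeroExt.sndHom K V).comp toSqZero.toLinearMap

@[simp]
theorem proj_ι (x : V) : proj K V (SymmetricAlgebra.ι K V x) = x := by
  simp [proj]

theorem proj_component {n : ℕ} (hn : n ≠ 1) {a : SymmetricAlgebra K V}
    (ha : a ∈ component K V n) : proj K V a = 0 := by
  let _ : Module Kᵐᵒᵖ V := Module.compHom _ ((RingHom.id K).fromOpposite mul_comm)
  have _ : IsCentralScalar K V := ⟨fun r m => rfl⟩
  change TrivSqZeroExt.snd (toSqZero a) = 0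
  have hfst : ∀ b ∈ component K V 1, (toSqZero b).fst = 0 := by
    intro b hb
    rw [component, pow_one] at hb
    obtain ⟨x, rfl⟩ := hb
    simp
  match n, hn, ha with
  | 0, _, ha =>
    rw [component, pow_zero, Submodule.one_eq_range] at ha
    obtain ⟨r, rfl⟩ := ha
    simp [TrivSqZeroExt.algebraMap_eq_inl]
  | n + 2, _, ha =>
    clear * - hfst ha
    rw [component, pow_add, pow_two] at ha
    rw [← mul_assoc] at ha
    have hfst' : ∀ b ∈ LinearMap.range (SymmetricAlgebra.ι K V) ^ n *
        LinearMap.range (SymmetricAlgebra.ι K V), (toSqZero b).fst = 0 := by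
      intro b hb
      induction hb using Submodule.mul_induction_on' with
      | mem_mul_mem p hp q hq =>
        rw [map_mul, TrivSqZeroExt.fst_mul, hfst q (by rwa [component, pow_one]), mul_zero]
      | add p hp q hq h1 h2 => rw [map_add, TrivSqZeroExt.fst_add, h1, h2, add_zero]
    induction ha using Submodule.mul_induction_on' with
    | mem_mul_mem p hp q hq =>
      rw [map_mul, TrivSqZeroExt.snd_mul, hfst' p hp, hfst q (by rwa [component, pow_one])]
      simp
    | add p hp q hq h1 h2 => rw [map_add, TrivSqZeroExt.snd_add, h1, h2, add_zero]

theorem proj_map (φ : V →ₗ[K] W) (a : SymmetricAlgebra K V) :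
    proj K W (map φ a) = φ (proj K V a) := by
  let _ : Module Kᵐᵒᵖ V := Module.compHom _ ((RingHom.id K).fromOpposite mul_comm)
  have _ : IsCentralScalar K V := ⟨fun r m => rfl⟩
  let _ : Module Kᵐᵒᵖ W := Module.compHom _ ((RingHom.id K).fromOpposite mul_comm)
  have _ : IsCentralScalar K W := ⟨fun r m => rfl⟩
  have h : (toSqZero (K := K) (V := W)).comp
        (map φ : SymmetricAlgebra K V →ₐ[K] SymmetricAlgebra K W)
      = (TrivSqZeroExt.map φ).comp (toSqZero (K := K) (V := V)) := by
    ext x <;> simp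
  have h2 := congrArg TrivSqZeroExt.snd (DFunLike.congr_fun h a)
  simpa [proj] using h2

end SymCoalg

/-- A cofree-cocommutative combinatorial Hopf algebra over `K`: a Hopf algebra `H` with a prescribed
isomorphism of coalgebras `H ≅ Sᶜ(R)`. Here `Sᶜ(R)` is `SymmetricAlgebra K R`, of which only the
coalgebra structure is used: the counital coproduct for which
`Δ(v₁ ⋯ vₙ) = ∑ v_I ⊗ v_J`, the sum being over all ordered partitions `I ⊔ J` of `{1, …, n}`.
Transporting the product of `H` along `iso` amounts to giving a product `*` on `Sᶜ(R)` which makes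
it a Hopf algebra. -/
structure CofreeCocommCHA (K : Type u) [Field K] where
  R : Type v
  [addCommGroupR : AddCommGroup R]
  [moduleR : Module K R]
  H : Type (max u v)
  [ringH : Ring H]
  [hopfH : HopfAlgebra K H]
  /-- The prescribed isomorphism of coalgebras. -/
  iso : H ≃ₗc[K] SymmetricAlgebra K R

namespace CofreeCocommCHA

attribute [instance] addCommGroupR moduleR ringH hopfH

variable {K : Type u} [Field K]

/-- The inclusion of `R = S¹(R)` in `H`. -/
def incl (A : CofreeCocommCHA.{u, v} K) : A.R →ₗ[K] A.H :=
  (A.iso.toLinearEquiv.symm : SymmetricAlgebra K A.R →ₗ[K] A.H) ∘ₗ SymmetricAlgebra.ι K A.R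

/-- The projection of `H` onto `R = S¹(R)`. -/
def projR (A : CofreeCocommCHA.{u, v} K) : A.H →ₗ[K] A.R :=
  SymCoalg.proj K A.R ∘ₗ (A.iso.toLinearEquiv : A.H →ₗ[K] SymmetricAlgebra K A.R)

/-- The grading `Hⁿ = Sⁿ(R)` of `H` as a vector space. -/
def graded (A : CofreeCocommCHA.{u, v} K) (n : ℕ) : Submodule K A.H :=
  (SymCoalg.component K A.R n).comap
    (A.iso.toLinearEquiv : A.H →ₗ[K] SymmetricAlgebra K A.R)

/-- The subspace `⨁_{n ≥ q} Hⁿ` of `H`. -/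
def filtration (A : CofreeCocommCHA.{u, v} K) (q : ℕ) : Submodule K A.H :=
  ⨆ n : ℕ, ⨆ _ : q ≤ n, A.graded n

/-- The multibrace operation `M₁₁ : R ⊗ R → R`, `x ⊗ y ↦` the component of `x * y` in `R`. -/
def M11 (A : CofreeCocommCHA.{u, v} K) : A.R →ₗ[K] A.R →ₗ[K] A.R :=
  ((LinearMap.mul K A.H).compl₁₂ A.incl A.incl).compr₂ A.projR

theorem M11_apply (A : CofreeCocommCHA.{u, v} K) (x y : A.R) :
    A.M11 x y = A.projR (A.incl x * A.incl y) := rfl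

/-- A morphism of cofree-cocommutative combinatorial Hopf algebras: a linear map `φ : R → R'` such
that, through the prescribed isomorphisms, `Sᶜ(φ)` is a morphism of Hopf algebras `H → H'`. -/
@[ext]
structure Hom (A B : CofreeCocommCHA.{u, v} K) where
  φ : A.R →ₗ[K] B.R
  isHopf : ∃ F : A.H →ₐc[K] B.H, ∀ a : A.H, B.iso (F a) = SymCoalg.map φ (A.iso a)

instance : Category (CofreeCocommCHA.{u, v} K) where
  Hom A B := Hom A B
  id A := ⟨LinearMap.id, BialgHom.id K A.H, fun a => (SymCoalg.map_id (A.iso a)).symm⟩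
  comp f g := ⟨g.φ ∘ₗ f.φ, by
    obtain ⟨F, hF⟩ := f.isHopf
    obtain ⟨G, hG⟩ := g.isHopf
    refine ⟨G.comp F, fun a => ?_⟩
    rw [SymCoalg.map_comp, ← hF, ← hG]
    rfl⟩

theorem Hom.map_M11 {A B : CofreeCocommCHA.{u, v} K} (f : Hom A B) (x y : A.R) :
    f.φ (A.M11 x y) = B.M11 (f.φ x) (f.φ y) := by
  obtain ⟨F, hF⟩ := f.isHopf
  have hincl : ∀ x : A.R, F (A.incl x) = B.incl (f.φ x) := by
    intro x
    apply B.iso.toLinearEquiv.injective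
    change B.iso (F (A.incl x)) = B.iso (B.incl (f.φ x))
    rw [hF]
    have h1 : A.iso (A.incl x) = SymmetricAlgebra.ι K A.R x :=
      A.iso.toLinearEquiv.apply_symm_apply _
    have h2 : B.iso (B.incl (f.φ x)) = SymmetricAlgebra.ι K B.R (f.φ x) :=
      B.iso.toLinearEquiv.apply_symm_apply _
    rw [h1, h2, SymCoalg.map_ι]
  have hproj : ∀ a : A.H, B.projR (F a) = f.φ (A.projR a) := by
    intro a
    change SymCoalg.proj K B.R (B.iso (F a)) = f.φ (SymCoalg.proj K A.R (A.iso a))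
    rw [hF, SymCoalg.proj_map]
  rw [M11_apply, M11_apply, ← hproj, map_mul, hincl, hincl]

/-- The right-sided condition **(r-s)**: every subspace `⨁_{n ≥ q} Hⁿ` is a right ideal of `H`. -/
def IsRightSided (K : Type u) [Field K] : ObjectProperty (CofreeCocommCHA.{u, v} K) :=
  fun A => ∀ q : ℕ, ∀ a ∈ A.filtration q, ∀ b : A.H, a * b ∈ A.filtration q

end CofreeCocommCHA

/-- The category of cofree-cocommutative right-sided combinatorial Hopf algebras. -/
abbrev RightSidedCHA (K : Type u) [Field K] :=
  (CofreeCocommCHA.IsRightSided.{u, v} K).FullSubcategory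

/-- A (right) pre-Lie algebra over `K`: a vector space with a bilinear product such that
`(xy)z - x(yz) = (xz)y - x(zy)`. -/
structure PreLieAlgCat (K : Type u) [Field K] where
  carrier : Type v
  [ring : RightPreLieRing carrier]
  [algebra : RightPreLieAlgebra K carrier]

namespace PreLieAlgCat

attribute [instance] ring algebra

variable {K : Type u} [Field K]

/-- A morphism of pre-Lie algebras is a linear map that preserves the products. -/
@[ext]
structure Hom (L L' : PreLieAlgCat.{u, v} K) where
  toNonUnitalAlgHom : L.carrier →ₙₐ[K] L'.carrier

instance : Category (PreLieAlgCat.{u, v} K) where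
  Hom L L' := Hom L L'
  id L := ⟨NonUnitalAlgHom.id K L.carrier⟩
  comp f g := ⟨g.toNonUnitalAlgHom.comp f.toNonUnitalAlgHom⟩

/-- The pre-Lie algebra given by a vector space and a bilinear product on it which satisfies the
pre-Lie identity. -/
def ofBilinear (V : Type v) [AddCommGroup V] [Module K V] (μ : V →ₗ[K] V →ₗ[K] V)
    (h : ∀ x y z : V, μ (μ x y) z - μ x (μ y z) = μ (μ x z) y - μ x (μ z y)) :
    PreLieAlgCat.{u, v} K :=
  letI ring : RightPreLieRing V :=
    { (inferInstance : AddCommGroup V) with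
      mul := fun x y => μ x y
      left_distrib := fun x y z => (μ x).map_add y z
      right_distrib := fun x y z => LinearMap.map_add₂ μ x y z
      zero_mul := fun x => LinearMap.map_zero₂ μ x
      mul_zero := fun x => (μ x).map_zero
      assoc_symm' := h }
  letI algebra : RightPreLieAlgebra K V :=
    { (inferInstance : Module K V) with
      smul_assoc := fun r x y => LinearMap.map_smul₂ μ r x y
      smul_comm := fun r x y => ((μ x).map_smul r y).symm }
  { carrier := V, ring := ring, algebra := algebra }

end PreLieAlgCat

/-- The functor from the right-sided combinatorial Hopf algebras to the pre-Lie algebras that sends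
`H ≅ Sᶜ(R)` to `(R, M₁₁)` and a morphism `φ : R → R'` to the map `φ` itself. It depends on the fact
that the operations `M₁₁` are pre-Lie. -/
def primFunctor (K : Type u) [Field K]
    (h : ∀ A : RightSidedCHA.{u, v} K, ∀ x y z : A.obj.R,
      A.obj.M11 (A.obj.M11 x y) z - A.obj.M11 x (A.obj.M11 y z)
        = A.obj.M11 (A.obj.M11 x z) y - A.obj.M11 x (A.obj.M11 z y)) :
    RightSidedCHA.{u, v} K ⥤ PreLieAlgCat.{u, v} K where
  obj A := PreLieAlgCat.ofBilinear A.obj.R A.obj.M11 (h A)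
  map f :=
    ⟨{ toFun := f.hom.φ
       map_smul' := f.hom.φ.map_smul
       map_zero' := f.hom.φ.map_zero
       map_add' := f.hom.φ.map_add
       map_mul' := CofreeCocommCHA.Hom.map_M11 f.hom }⟩
  map_id _ := rfl
  map_comp _ _ := rfl

end

/-! Everything rests on one operator. For `y` in `R`, right multiplication by the primitive element
`y` is a coderivation of `H`. In characteristic zero the primitives of `S(V)` are exactly `V`, so a
coderivation of `S(V)` is determined by its projection to `V` (`IsCoderivation.eq_zero`).
Right-sidedness kills that projection in degrees at least 2; in degrees 0 and 1 it is given by `y`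
and `M₁₁(-, y)`. Hence right multiplication by `y` is `rmul M₁₁ y`, the polynomial multiplication by
`y` plus the derivation extending `M₁₁(-, y)` (`IsRightSided.iso_mul_incl`).

The bracket formula is read off at once, and projecting `x * [y, z]` to `R` in two ways gives the
pre-Lie identity. Since `1` generates `S(R)` under the operators `rmul M₁₁ y`, the product is
determined by `M₁₁`; a linear map compatible with `M₁₁` is therefore multiplicative, which gives
fullness.

Conversely, for a pre-Lie algebra `L` the operators `rmul` satisfy the commutation relations of a
right action of the Lie algebra `L` on `S(L)`, so `U(L)` acts. The orbit map of `1` is an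
isomorphism of coalgebras `U(L) ≅ S(L)`: it is unitriangular for word length. Transport along it
yields a right-sided CHA with `M₁₁` the given product. -/

noncomputable section

/-! ### Derivations and coderivations of the symmetric algebra -/

namespace SymCoalg

open SymmetricAlgebra

variable {K : Type u} [Field K] {V W : Type v} [AddCommGroup V] [Module K V]
  [AddCommGroup W] [Module K W]

/-- The algebra map `S(V) → S(V)[ε]` which sends `v` to `v + ε δ(v)`. -/
def derHom (δ : V →ₗ[K] V) :
    SymmetricAlgebra K V →ₐ[K] TrivSqZeroExt (SymmetricAlgebra K V) (SymmetricAlgebra K V) :=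
  lift ((TrivSqZeroExt.inlAlgHom K _ _).toLinearMap ∘ₗ ι K V +
    (TrivSqZeroExt.inrHom _ _).restrictScalars K ∘ₗ ι K V ∘ₗ δ)

theorem fst_derHom (δ : V →ₗ[K] V) (a : SymmetricAlgebra K V) : (derHom δ a).fst = a := by
  have h : (TrivSqZeroExt.fstHom K (SymmetricAlgebra K V) (SymmetricAlgebra K V)).comp (derHom δ)
      = AlgHom.id K _ := by
    ext x
    simp [derHom]
  exact DFunLike.congr_fun h a

/-- The derivation of the symmetric algebra which extends a linear endomorphism. -/
def der (δ : V →ₗ[K] V) : SymmetricAlgebra K V →ₗ[K] SymmetricAlgebra K V :=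
  (TrivSqZeroExt.sndHom _ _).restrictScalars K ∘ₗ (derHom δ).toLinearMap

@[simp]
theorem der_ι (δ : V →ₗ[K] V) (x : V) : der δ (ι K V x) = ι K V (δ x) := by
  simp [der, derHom]

theorem der_mul (δ : V →ₗ[K] V) (a b : SymmetricAlgebra K V) :
    der δ (a * b) = a * der δ b + b * der δ a := by
  simp [der, fst_derHom, mul_comm b]

@[simp]
theorem der_algebraMap (δ : V →ₗ[K] V) (r : K) :
    der δ (algebraMap K (SymmetricAlgebra K V) r) = 0 := by
  simp [der, TrivSqZeroExt.algebraMap_eq_inl']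

@[simp]
theorem der_one (δ : V →ₗ[K] V) : der δ (1 : SymmetricAlgebra K V) = 0 := by
  simp [der]

theorem counit_der (δ : V →ₗ[K] V) (a : SymmetricAlgebra K V) :
    Coalgebra.counit (R := K) (der δ a) = 0 := by
  induction a using SymmetricAlgebra.induction with
  | algebraMap r => simp
  | ι x => simp
  | mul a b ha hb => simp [der_mul, ha, hb]
  | add a b ha hb => simp [ha, hb]

/-- A linear endomorphism `ρ` of a coalgebra is a coderivation when `Δ ρ = (ρ ⊗ 1 + 1 ⊗ ρ) Δ`. -/
def IsCoderivation {C : Type*} [AddCommGroup C] [Module K C] [Coalgebra K C] (ρ : C →ₗ[K] C) :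
    Prop :=
  ∀ a, Coalgebra.comul (R := K) (ρ a) =
    ρ.rTensor C (Coalgebra.comul (R := K) a) + ρ.lTensor C (Coalgebra.comul (R := K) a)

theorem IsCoderivation.add {C : Type*} [AddCommGroup C] [Module K C] [Coalgebra K C]
    {ρ σ : C →ₗ[K] C} (hρ : IsCoderivation ρ) (hσ : IsCoderivation σ) :
    IsCoderivation (ρ + σ) := by
  intro a
  simp only [LinearMap.add_apply, map_add, hρ a, hσ a, LinearMap.rTensor_add,
    LinearMap.lTensor_add]
  abel

theorem IsCoderivation.sub {C : Type*} [AddCommGroup C] [Module K C] [Coalgebra K C]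
    {ρ σ : C →ₗ[K] C} (hρ : IsCoderivation ρ) (hσ : IsCoderivation σ) :
    IsCoderivation (ρ - σ) := by
  intro a
  simp only [LinearMap.sub_apply, map_sub, hρ a, hσ a, LinearMap.rTensor_sub,
    LinearMap.lTensor_sub]
  abel

theorem isCoderivation_mulRight {A : Type*} [Ring A] [Bialgebra K A] {y : A}
    (hy : Coalgebra.comul (R := K) y = y ⊗ₜ[K] 1 + 1 ⊗ₜ[K] y) :
    IsCoderivation (LinearMap.mulRight K y) := by
  intro a
  rw [LinearMap.mulRight_apply, Bialgebra.comul_mul, hy, mul_add]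
  generalize Coalgebra.comul (R := K) a = t
  induction t with
  | zero => simp
  | tmul b c => simp
  | add s t hs ht =>
    simp only [add_mul, map_add] at hs ht ⊢
    -- The ring need not be commutative, so additivity in `t` is used by writing `0 = 0 + 0` and
    -- replacing the zeros by the two differences.
    rw [← sub_eq_zero] at hs ht ⊢
    rw [← add_zero (0 : A ⊗[K] A)]
    nth_rw 1 [← hs, ← ht]
    abel

theorem tensor_der_mul (δ : V →ₗ[K] V) (s t : SymmetricAlgebra K V ⊗[K] SymmetricAlgebra K V) :
    (der δ).rTensor _ (s * t) + (der δ).lTensor _ (s * t) =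
      s * ((der δ).rTensor _ t + (der δ).lTensor _ t) +
      t * ((der δ).rTensor _ s + (der δ).lTensor _ s) := by
  induction s with
  | zero => simp
  | add s s' hs hs' =>
    simp only [add_mul, map_add] at hs hs' ⊢
    linear_combination hs + hs'
  | tmul a b =>
    induction t with
    | zero => simp
    | add t t' ht ht' =>
      simp only [add_mul, mul_add, map_add] at ht ht' ⊢
      linear_combination ht + ht'
    | tmul c d =>
      simp only [Algebra.TensorProduct.tmul_mul_tmul, LinearMap.rTensor_tmul,
        LinearMap.lTensor_tmul, der_mul, TensorProduct.add_tmul, TensorProduct.tmul_add, mul_add,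
        mul_comm a c, mul_comm b d]
      abel

/-- Both sides are derivations along the algebra map `Δ`, the right one by `tensor_der_mul`, so
agreement on generators suffices. -/
theorem isCoderivation_der (δ : V →ₗ[K] V) : IsCoderivation (der δ) := by
  intro a
  induction a using SymmetricAlgebra.induction with
  | algebraMap r => simp [Algebra.TensorProduct.one_def, Algebra.algebraMap_eq_smul_one]
  | ι x => simp
  | mul a b ha hb =>
    rw [Bialgebra.comul_mul, tensor_der_mul, ← ha, ← hb, der_mul, map_add, Bialgebra.comul_mul,
      Bialgebra.comul_mul]
  | add a b ha hb => simp only [map_add, ha, hb]; abel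

/-- The operator `b ↦ b · y + ∑ x₁ ⋯ μ(xᵢ, y) ⋯ xₙ`, `b = x₁ ⋯ xₙ`, on the symmetric algebra. -/
def rmul (μ : V →ₗ[K] V →ₗ[K] V) (y : V) : SymmetricAlgebra K V →ₗ[K] SymmetricAlgebra K V :=
  LinearMap.mulRight K (ι K V y) + der (μ.flip y)

theorem rmul_apply (μ : V →ₗ[K] V →ₗ[K] V) (y : V) (a : SymmetricAlgebra K V) :
    rmul μ y a = a * ι K V y + der (μ.flip y) a := rfl

@[simp]
theorem rmul_one (μ : V →ₗ[K] V →ₗ[K] V) (y : V) : rmul μ y 1 = ι K V y := by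
  simp [rmul_apply]

theorem rmul_ι (μ : V →ₗ[K] V →ₗ[K] V) (x y : V) :
    rmul μ y (ι K V x) = ι K V x * ι K V y + ι K V (μ x y) := by
  simp [rmul_apply]

theorem isCoderivation_rmul (μ : V →ₗ[K] V →ₗ[K] V) (y : V) : IsCoderivation (rmul μ y) :=
  (isCoderivation_mulRight (comul_ι K V y)).add (isCoderivation_der _)

theorem counit_rmul (μ : V →ₗ[K] V →ₗ[K] V) (y : V) (a : SymmetricAlgebra K V) :
    Coalgebra.counit (R := K) (rmul μ y a) = 0 := by
  rw [rmul_apply, map_add, counit_der, Bialgebra.counit_mul, counit_ι, mul_zero, add_zero]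

theorem map_der (φ : V →ₗ[K] W) (δ : V →ₗ[K] V) (δ' : W →ₗ[K] W)
    (h : ∀ x, φ (δ x) = δ' (φ x)) (a : SymmetricAlgebra K V) :
    map φ (der δ a) = der δ' (map φ a) := by
  induction a using SymmetricAlgebra.induction with
  | algebraMap r => simp [Algebra.algebraMap_eq_smul_one]
  | ι x => simp [h]
  | mul a b ha hb => simp [der_mul, ha, hb]
  | add a b ha hb => simp [ha, hb]

theorem map_rmul (φ : V →ₗ[K] W) (μ : V →ₗ[K] V →ₗ[K] V) (ν : W →ₗ[K] W →ₗ[K] W)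
    (h : ∀ x y, φ (μ x y) = ν (φ x) (φ y)) (y : V) (a : SymmetricAlgebra K V) :
    map φ (rmul μ y a) = rmul ν (φ y) (map φ a) := by
  rw [rmul_apply, rmul_apply, map_add, map_mul, map_ι,
    map_der φ (μ.flip y) (ν.flip (φ y)) (fun x => h x y)]

/-! ### The components -/

theorem ι_mem_component (x : V) : ι K V x ∈ component K V 1 := by
  rw [component, pow_one]
  exact ⟨x, rfl⟩

theorem mem_component_one {a : SymmetricAlgebra K V} :
    a ∈ component K V 1 ↔ ∃ x, ι K V x = a := by
  rw [component, pow_one]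
  exact Iff.rfl

theorem mem_component_zero {a : SymmetricAlgebra K V} :
    a ∈ component K V 0 ↔ ∃ r, algebraMap K _ r = a := by
  rw [component, pow_zero, Submodule.one_eq_range]
  exact Iff.rfl

theorem mul_mem_component {m n : ℕ} {a b : SymmetricAlgebra K V} (ha : a ∈ component K V m)
    (hb : b ∈ component K V n) : a * b ∈ component K V (m + n) := by
  rw [component, pow_add]
  exact Submodule.mul_mem_mul ha hb

theorem component_succ_le {n : ℕ} {N : Submodule K (SymmetricAlgebra K V)}
    (h : ∀ a ∈ component K V n, ∀ x, a * ι K V x ∈ N) : component K V (n + 1) ≤ N := by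
  rw [component, pow_succ, Submodule.mul_le]
  rintro a ha _ ⟨x, rfl⟩
  exact h a ha x

theorem der_mem_component (δ : V →ₗ[K] V) {n : ℕ} {a : SymmetricAlgebra K V}
    (ha : a ∈ component K V n) : der δ a ∈ component K V n := by
  induction n generalizing a with
  | zero =>
    obtain ⟨r, rfl⟩ := mem_component_zero.1 ha
    simp
  | succ n ih =>
    suffices h : component K V (n + 1) ≤ (component K V (n + 1)).comap (der δ) from h ha
    refine component_succ_le fun a ha x => ?_
    rw [Submodule.mem_comap, der_mul, der_ι, mul_comm (ι K V x)]
    exact add_mem (mul_mem_component ha (ι_mem_component _))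
      (mul_mem_component (ih ha) (ι_mem_component _))

theorem iSup_component : ⨆ n, component K V n = ⊤ := by
  refine Submodule.eq_top_iff'.2 fun a => ?_
  induction a using SymmetricAlgebra.induction with
  | algebraMap r =>
    exact Submodule.mem_iSup_of_mem 0 (mem_component_zero.2 ⟨r, rfl⟩)
  | ι x => exact Submodule.mem_iSup_of_mem 1 (ι_mem_component x)
  | mul a b ha hb =>
    induction ha using Submodule.iSup_induction' with
    | zero => simp
    | add x y _ _ hx hy => rw [add_mul]; exact add_mem hx hy
    | mem m x hx =>
      induction hb using Submodule.iSup_induction' with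
      | zero => simp
      | add x y _ _ hx hy => rw [mul_add]; exact add_mem hx hy
      | mem n y hy => exact Submodule.mem_iSup_of_mem (m + n) (mul_mem_component hx hy)
  | add a b ha hb => exact add_mem ha hb

theorem eq_top_of_component_le {N : Submodule K (SymmetricAlgebra K V)}
    (h : ∀ n, component K V n ≤ N) : N = ⊤ :=
  top_le_iff.1 (iSup_component (K := K) (V := V) ▸ iSup_le h)

theorem linearMap_ext_component {M : Type*} [AddCommGroup M] [Module K M]
    {f g : SymmetricAlgebra K V →ₗ[K] M} (h : ∀ n, ∀ a ∈ component K V n, f a = g a) : f = g := by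
  rw [← LinearMap.eqLocus_eq_top]
  exact eq_top_of_component_le h

/-- `S(V)` is generated by `1` under the operators `rmul μ y`. -/
theorem eq_top_of_rmul_mem (μ : V →ₗ[K] V →ₗ[K] V) {N : Submodule K (SymmetricAlgebra K V)}
    (h1 : 1 ∈ N) (hN : ∀ y, ∀ a ∈ N, rmul μ y a ∈ N) : N = ⊤ := by
  refine eq_top_of_component_le fun n => ?_
  induction n with
  | zero =>
    intro a ha
    obtain ⟨r, rfl⟩ := mem_component_zero.1 ha
    rw [Algebra.algebraMap_eq_smul_one]
    exact N.smul_mem r h1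
  | succ n ih =>
    refine component_succ_le fun a ha x => ?_
    -- `a x` is `rmul μ x a` minus a derivation term that still has degree `n`, to which the
    -- induction hypothesis applies.
    rw [← add_sub_cancel_right (a * ι K V x) (der (μ.flip x) a), ← rmul_apply]
    exact sub_mem (hN x a (ih ha)) (ih (der_mem_component _ ha))

theorem counit_component {n : ℕ} (hn : n ≠ 0) {a : SymmetricAlgebra K V}
    (ha : a ∈ component K V n) : Coalgebra.counit (R := K) a = 0 := by
  obtain ⟨n, rfl⟩ := Nat.exists_eq_succ_of_ne_zero hn
  suffices h : component K V (n + 1) ≤ LinearMap.ker (Coalgebra.counit (R := K)) from h ha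
  exact component_succ_le fun a _ x => by simp

/-- `rmul μ y` maps degree `n` into degrees `n` and `n + 1`, so only degrees 0 and 1 reach `V`. -/
theorem proj_rmul (μ : V →ₗ[K] V →ₗ[K] V) (y : V) (a : SymmetricAlgebra K V) :
    proj K V (rmul μ y a) = Coalgebra.counit (R := K) a • y + μ (proj K V a) y := by
  have h : proj K V ∘ₗ rmul μ y =
      (Coalgebra.counit (R := K)).smulRight y + μ.flip y ∘ₗ proj K V := by
    refine linearMap_ext_component fun n a ha => ?_
    simp only [LinearMap.comp_apply, LinearMap.add_apply, LinearMap.smulRight_apply,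
      LinearMap.flip_apply]
    match n, ha with
    | 0, ha =>
      obtain ⟨r, rfl⟩ := mem_component_zero.1 ha
      have h0 : proj K V (1 : SymmetricAlgebra K V) = 0 :=
        proj_component zero_ne_one (mem_component_zero.2 ⟨1, map_one _⟩)
      simp [Algebra.algebraMap_eq_smul_one, h0]
    | 1, ha =>
      obtain ⟨x, rfl⟩ := mem_component_one.1 ha
      rw [rmul_ι, map_add, proj_component (n := 2) (by simp)
        (mul_mem_component (ι_mem_component x) (ι_mem_component y))]
      simp
    | n + 2, ha =>
      rw [rmul_apply, map_add, proj_component (by lia) (mul_mem_component ha (ι_mem_component y)),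
        proj_component (by lia) (der_mem_component _ ha), proj_component (by lia) ha,
        counit_component (by lia) ha]
      simp
  exact LinearMap.congr_fun h a

/-! ### Primitive and group-like elements -/

/-- Both sides are algebra maps, by commutativity. The operator has eigenvalue `2 ^ n` on degree
`n`, which lets the coproduct detect degree. -/
theorem mul'_comul (a : SymmetricAlgebra K V) :
    LinearMap.mul' K _ (Coalgebra.comul (R := K) a) = map ((2 : K) • LinearMap.id) a := by
  have h : (Algebra.TensorProduct.lmul' K).comp (Bialgebra.comulAlgHom K (SymmetricAlgebra K V)) =
      (map ((2 : K) • LinearMap.id : V →ₗ[K] V) :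
        SymmetricAlgebra K V →ₐ[K] SymmetricAlgebra K V) := by
    ext x
    simp [two_smul]
  exact DFunLike.congr_fun h a

theorem map_smul_id_component (c : K) {n : ℕ} {a : SymmetricAlgebra K V}
    (ha : a ∈ component K V n) : map (c • LinearMap.id) a = c ^ n • a := by
  induction n generalizing a with
  | zero =>
    obtain ⟨r, rfl⟩ := mem_component_zero.1 ha
    simp [Algebra.algebraMap_eq_smul_one]
  | succ n ih =>
    suffices h : component K V (n + 1) ≤ LinearMap.eqLocus
        (map (c • LinearMap.id : V →ₗ[K] V)).toCoalgHom.toLinearMap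
        (c ^ (n + 1) • LinearMap.id) from h ha
    refine component_succ_le fun a ha x => ?_
    change map (c • LinearMap.id) (a * ι K V x) = c ^ (n + 1) • (a * ι K V x)
    simp [ih ha, pow_succ, smul_smul, mul_comm]

/-- In characteristic zero the eigenvalues `2 ^ n` are distinct, and eigenspaces are independent:
the part of `a` outside degree 1 lies both in the eigenspace of 2 and in the sum of the others, so
it vanishes. -/
theorem mem_range_ι_of_map_two_smul [CharZero K] {a : SymmetricAlgebra K V}
    (ha : map ((2 : K) • LinearMap.id) a = (2 : K) • a) : ∃ x, ι K V x = a := by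
  let Ψ : Module.End K (SymmetricAlgebra K V) :=
    (map ((2 : K) • LinearMap.id : V →ₗ[K] V)).toCoalgHom.toLinearMap
  have hΨ : ∀ n, component K V n ≤ Ψ.eigenspace (2 ^ n) := fun n b hb =>
    Module.End.mem_eigenspace_iff.2 (map_smul_id_component 2 hb)
  have ha' : a ∈ Ψ.eigenspace 2 := Module.End.mem_eigenspace_iff.2 ha
  have hle : (⊤ : Submodule K (SymmetricAlgebra K V)) ≤
      component K V 1 ⊔ ⨆ c, ⨆ _ : c ≠ (2 : K), Ψ.eigenspace c := by
    rw [← iSup_component]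
    refine iSup_le fun n => ?_
    by_cases hn : n = 1
    · subst hn
      exact le_sup_left
    · refine le_sup_of_le_right ((hΨ n).trans (le_iSup₂_of_le ((2 : K) ^ n) ?_ le_rfl))
      intro h
      have h2 : ((2 ^ n : ℕ) : K) = ((2 ^ 1 : ℕ) : K) := by simpa using h
      exact hn (Nat.pow_right_injective le_rfl (Nat.cast_injective h2))
  obtain ⟨b, hb, c, hc, rfl⟩ := Submodule.mem_sup.1 (hle (Submodule.mem_top (x := a)))
  have hb' : b ∈ Ψ.eigenspace 2 := by simpa using hΨ 1 hb
  have hc' : c ∈ Ψ.eigenspace 2 := by simpa using sub_mem ha' hb'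
  rw [Submodule.disjoint_def.1 (Module.End.eigenspaces_iSupIndep Ψ 2) c hc' hc, add_zero]
  exact mem_component_one.1 hb

theorem comul_eq_iff [CharZero K] {a : SymmetricAlgebra K V} :
    Coalgebra.comul (R := K) a = a ⊗ₜ[K] 1 + 1 ⊗ₜ[K] a ↔ ∃ x, ι K V x = a := by
  constructor
  · intro h
    refine mem_range_ι_of_map_two_smul ?_
    rw [← mul'_comul, h]
    simp [two_smul]
  · rintro ⟨x, rfl⟩
    exact comul_ι K V x

theorem mul'_antipode_comul (a : SymmetricAlgebra K V) :
    LinearMap.mul' K _ ((map (-LinearMap.id : V →ₗ[K] V)).toCoalgHom.toLinearMap.rTensor _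
      (Coalgebra.comul (R := K) a)) = algebraMap K _ (Coalgebra.counit (R := K) a) := by
  have h : ((Algebra.TensorProduct.lmul' K).comp (Algebra.TensorProduct.map
      (map (-LinearMap.id : V →ₗ[K] V) : SymmetricAlgebra K V →ₐ[K] SymmetricAlgebra K V)
      (AlgHom.id K _))).comp (Bialgebra.comulAlgHom K (SymmetricAlgebra K V)) =
      (Algebra.ofId K _).comp (Bialgebra.counitAlgHom K _) := by
    ext x
    simp [algebraMapInv_ι]
  exact DFunLike.congr_fun h a

/-- The only group-like element of `S(V)` is `1`. -/
theorem eq_one_of_comul_eq {g : SymmetricAlgebra K V}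
    (h : Coalgebra.comul (R := K) g = g ⊗ₜ[K] g) (h1 : Coalgebra.counit (R := K) g = 1) :
    g = 1 := by
  -- The antipode `S(-id)` provides an inverse of a group-like element; the units of a polynomial
  -- ring over a field are constants.
  have hu : IsUnit g := by
    have h2 := mul'_antipode_comul g
    rw [h, h1, LinearMap.rTensor_tmul, LinearMap.mul'_apply, map_one] at h2
    exact IsUnit.of_mul_eq_one_right _ h2
  let b := Module.Basis.ofVectorSpace K V
  obtain ⟨r, -, hr⟩ := MvPolynomial.isUnit_iff_eq_C_of_isReduced.1
    (hu.map (equivMvPolynomial b))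
  have hg : g = algebraMap K _ r := by
    apply (equivMvPolynomial b).injective
    rw [hr, AlgEquiv.commutes, MvPolynomial.algebraMap_eq]
  rw [hg, Bialgebra.counit_algebraMap] at h1
  rw [hg, h1, map_one]

/-! ### Coderivations -/

/-- The span of the components of degree less than `n`. -/
def lower (K : Type*) [Field K] (V : Type*) [AddCommGroup V] [Module K V] (n : ℕ) :
    Submodule K (SymmetricAlgebra K V) :=
  ⨆ m : ℕ, ⨆ _ : m < n, component K V m

theorem component_le_lower {m n : ℕ} (h : m < n) : component K V m ≤ lower K V n :=
  le_iSup₂_of_le m h le_rfl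

theorem lower_mono {m n : ℕ} (h : m ≤ n) : lower K V m ≤ lower K V n :=
  iSup₂_le fun _ hk => component_le_lower (hk.trans_le h)

theorem mul_ι_mem_lower {n : ℕ} {a : SymmetricAlgebra K V} (ha : a ∈ lower K V n) (x : V) :
    a * ι K V x ∈ lower K V (n + 1) := by
  suffices h : lower K V n ≤ (lower K V (n + 1)).comap (LinearMap.mulRight K (ι K V x)) from h ha
  exact iSup₂_le fun m hm b hb => component_le_lower (Nat.succ_lt_succ hm)
    (mul_mem_component hb (ι_mem_component x))

/-- The reduced coproduct involves only lower degrees, so a coderivation that vanishes there sends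
`a` to a primitive element. -/
theorem comul_sub_mem {n : ℕ} {a : SymmetricAlgebra K V} (ha : a ∈ component K V (n + 1)) :
    Coalgebra.comul (R := K) a - (a ⊗ₜ[K] 1 + 1 ⊗ₜ[K] a) ∈
      Submodule.map₂ (TensorProduct.mk K _ _) (lower K V (n + 1)) (lower K V (n + 1)) := by
  induction n generalizing a with
  | zero =>
    obtain ⟨x, rfl⟩ := mem_component_one.1 ha
    simp
  | succ n ih =>
    set T := Submodule.map₂ (TensorProduct.mk K _ _) (lower K V (n + 1 + 1)) (lower K V (n + 1 + 1))
      with hT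
    suffices h : component K V (n + 1 + 1) ≤ T.comap (Coalgebra.comul (R := K) -
        ((TensorProduct.mk K _ _).flip 1 + TensorProduct.mk K _ _ 1)) from h ha
    refine component_succ_le fun a ha x => ?_
    -- The reduced coproduct of `a x` is that of `a` times `Δ x`, plus the cross terms `a ⊗ x + x ⊗
    -- a`.
    have h1 : Coalgebra.comul (R := K) (a * ι K V x) -
        ((a * ι K V x) ⊗ₜ[K] 1 + 1 ⊗ₜ[K] (a * ι K V x)) =
        (Coalgebra.comul (R := K) a - (a ⊗ₜ[K] 1 + 1 ⊗ₜ[K] a)) *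
          (ι K V x ⊗ₜ[K] 1 + 1 ⊗ₜ[K] ι K V x) + (a ⊗ₜ[K] ι K V x + ι K V x ⊗ₜ[K] a) := by
      simp only [Bialgebra.comul_mul, comul_ι, sub_mul, add_mul, mul_add,
        Algebra.TensorProduct.tmul_mul_tmul, one_mul, mul_one]
      abel
    change Coalgebra.comul (R := K) (a * ι K V x) -
        ((a * ι K V x) ⊗ₜ[K] 1 + 1 ⊗ₜ[K] (a * ι K V x)) ∈ T
    have hx : ι K V x ∈ lower K V (n + 1 + 1) := component_le_lower (by lia) (ι_mem_component x)
    have ha' : a ∈ lower K V (n + 1 + 1) := component_le_lower (by lia) ha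
    rw [h1]
    refine add_mem ?_ (add_mem (Submodule.apply_mem_map₂ _ ha' hx)
      (Submodule.apply_mem_map₂ _ hx ha'))
    suffices h : Submodule.map₂ (TensorProduct.mk K _ _) (lower K V (n + 1)) (lower K V (n + 1)) ≤
        T.comap (LinearMap.mulRight K (ι K V x ⊗ₜ[K] 1 + 1 ⊗ₜ[K] ι K V x)) from h (ih ha)
    refine Submodule.map₂_le.2 fun b hb c hc => ?_
    rw [Submodule.mem_comap, LinearMap.mulRight_apply, TensorProduct.mk_apply, mul_add,
      Algebra.TensorProduct.tmul_mul_tmul, Algebra.TensorProduct.tmul_mul_tmul, mul_one, mul_one]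
    exact add_mem
      (Submodule.apply_mem_map₂ _ (mul_ι_mem_lower hb x) (lower_mono (Nat.le_succ _) hc))
      (Submodule.apply_mem_map₂ _ (lower_mono (Nat.le_succ _) hb) (mul_ι_mem_lower hc x))

/-- A coderivation of `S(V)` is determined by its composition with the projection to `V`. -/
theorem IsCoderivation.eq_zero [CharZero K] {δ : SymmetricAlgebra K V →ₗ[K] SymmetricAlgebra K V}
    (hδ : IsCoderivation δ) (h : ∀ a, proj K V (δ a) = 0) : δ = 0 := by
  have hprim : ∀ a, Coalgebra.comul (R := K) (δ a) = δ a ⊗ₜ[K] 1 + 1 ⊗ₜ[K] δ a → δ a = 0 := by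
    intro a ha
    obtain ⟨x, hx⟩ := comul_eq_iff.1 ha
    have h2 := h a
    rw [← hx, proj_ι] at h2
    rw [← hx, h2, map_zero]
  have h1 : δ 1 = 0 := hprim 1 (by rw [hδ]; simp [Algebra.TensorProduct.one_def])
  -- Induction on degree: once `δ` vanishes in lower degrees, `δ a` is primitive, hence zero by
  -- `hprim`.
  have hle : ∀ n, component K V n ≤ LinearMap.ker δ := by
    intro n
    induction n using Nat.strong_induction_on with
    | _ n ih =>
    intro a ha
    match n, ih, ha with
    | 0, _, ha =>
      obtain ⟨r, rfl⟩ := mem_component_zero.1 ha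
      simp [Algebra.algebraMap_eq_smul_one, h1]
    | n + 1, ih, ha =>
      refine hprim a ?_
      have hlow : lower K V (n + 1) ≤ LinearMap.ker δ := iSup₂_le ih
      have hT : Submodule.map₂ (TensorProduct.mk K _ _) (lower K V (n + 1)) (lower K V (n + 1)) ≤
          LinearMap.ker (δ.rTensor _ + δ.lTensor _) := by
        refine Submodule.map₂_le.2 fun b hb c hc => ?_
        simp [LinearMap.mem_ker.1 (hlow hb), LinearMap.mem_ker.1 (hlow hc)]
      have h2 := hT (comul_sub_mem ha)
      rw [LinearMap.mem_ker, map_sub, sub_eq_zero, LinearMap.add_apply] at h2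
      rw [hδ, h2]
      simp [h1]
  exact linearMap_ext_component fun n a ha => hle n ha

end SymCoalg

namespace SymCoalg

theorem IsCoderivation.conj {K C D : Type*} [Field K] [AddCommGroup C] [Module K C] [Coalgebra K C]
    [AddCommGroup D] [Module K D] [Coalgebra K D] (e : C ≃ₗc[K] D) {ρ : C →ₗ[K] C}
    (hρ : IsCoderivation ρ) :
    IsCoderivation ((e.toLinearEquiv : C →ₗ[K] D) ∘ₗ ρ ∘ₗ
      (e.toLinearEquiv.symm : D →ₗ[K] C)) := by
  intro d
  obtain ⟨c, rfl⟩ := e.toLinearEquiv.surjective d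
  simp only [LinearMap.comp_apply, LinearEquiv.coe_coe, LinearEquiv.symm_apply_apply]
  have h1 : ∀ c : C, Coalgebra.comul (R := K) (e.toLinearEquiv c) =
      TensorProduct.map (e.toLinearEquiv : C →ₗ[K] D) (e.toLinearEquiv : C →ₗ[K] D)
        (Coalgebra.comul (R := K) c) :=
    fun c => (CoalgHomClass.map_comp_comul_apply e c).symm
  change Coalgebra.comul (R := K) (e.toLinearEquiv (ρ c)) = _
  rw [h1, h1, hρ c, map_add]
  generalize Coalgebra.comul (R := K) c = t
  induction t with
  | zero => simp
  | tmul b c => simp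
  | add s t hs ht =>
    simp only [map_add] at hs ht ⊢
    rw [add_add_add_comm, hs, ht, add_add_add_comm]

end SymCoalg

/-! ### The product of a right-sided combinatorial Hopf algebra -/

namespace CofreeCocommCHA

open SymCoalg SymmetricAlgebra

variable {K : Type u} [Field K] (A : CofreeCocommCHA.{u, v} K)

theorem comul_iso (a : A.H) : Coalgebra.comul (R := K) (A.iso a) =
    TensorProduct.map (A.iso.toLinearEquiv : A.H →ₗ[K] SymmetricAlgebra K A.R)
      (A.iso.toLinearEquiv : A.H →ₗ[K] SymmetricAlgebra K A.R) (Coalgebra.comul (R := K) a) :=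
  (CoalgHomClass.map_comp_comul_apply A.iso a).symm

theorem counit_iso (a : A.H) :
    Coalgebra.counit (R := K) (A.iso a) = Coalgebra.counit (R := K) a :=
  CoalgHomClass.counit_comp_apply A.iso a

/-- `iso` is only a map of coalgebras; it preserves the unit because `S(R)` has a single group-like
element. -/
theorem iso_one : A.iso 1 = 1 := by
  refine eq_one_of_comul_eq ?_ ?_
  · rw [comul_iso, Bialgebra.comul_one, Algebra.TensorProduct.one_def, TensorProduct.map_tmul]
    rfl
  · rw [counit_iso, Bialgebra.counit_one]

theorem iso_incl (x : A.R) : A.iso (A.incl x) = ι K A.R x :=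
  A.iso.toLinearEquiv.apply_symm_apply _

theorem projR_apply (a : A.H) : A.projR a = proj K A.R (A.iso a) := rfl

theorem iso_injective : Function.Injective A.iso := A.iso.toLinearEquiv.injective

theorem comul_eq_iff_iso {a : A.H} :
    Coalgebra.comul (R := K) a = a ⊗ₜ[K] 1 + 1 ⊗ₜ[K] a ↔
      Coalgebra.comul (R := K) (A.iso a) = A.iso a ⊗ₜ[K] 1 + 1 ⊗ₜ[K] A.iso a := by
  have hinj : Function.Injective (TensorProduct.congr A.iso.toLinearEquiv A.iso.toLinearEquiv) :=
    LinearEquiv.injective _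
  rw [← hinj.eq_iff, comul_iso, ← A.iso_one, map_add]
  exact Iff.rfl

theorem comul_incl (x : A.R) :
    Coalgebra.comul (R := K) (A.incl x) = A.incl x ⊗ₜ[K] 1 + 1 ⊗ₜ[K] A.incl x := by
  rw [comul_eq_iff_iso, iso_incl, comul_ι]

theorem mem_graded {n : ℕ} {a : A.H} : a ∈ A.graded n ↔ A.iso a ∈ component K A.R n := Iff.rfl

theorem projR_of_mem_filtration {a : A.H} (ha : a ∈ A.filtration 2) : A.projR a = 0 := by
  suffices h : A.filtration 2 ≤ LinearMap.ker A.projR from h ha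
  exact iSup₂_le fun n hn b hb => proj_component (by lia) (A.mem_graded.1 hb)

variable {A} [CharZero K]

/-- In a right-sided combinatorial Hopf algebra, the right multiplication by an element `y` of `R`
is `x₁ ⋯ xₙ ↦ x₁ ⋯ xₙ y + ∑ x₁ ⋯ M₁₁(xᵢ, y) ⋯ xₙ`. -/
theorem IsRightSided.iso_mul_incl (hA : IsRightSided K A) (a : A.H) (y : A.R) :
    A.iso (a * A.incl y) = rmul A.M11 y (A.iso a) := by
  -- The difference of the two operators is a coderivation, so it suffices that its projection to
  -- `R` vanishes, which is checked degree by degree.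
  have hρ := ((isCoderivation_mulRight (A.comul_incl y)).conj A.iso).sub
    (isCoderivation_rmul A.M11 y)
  have h0 := hρ.eq_zero fun s => by
    obtain ⟨a, rfl⟩ : ∃ a, A.iso a = s := A.iso.toLinearEquiv.surjective s
    have h1 : (A.iso.toLinearEquiv.symm (A.iso a)) = a := A.iso.toLinearEquiv.symm_apply_apply a
    simp only [LinearMap.sub_apply, LinearMap.comp_apply, LinearEquiv.coe_coe, h1, map_sub,
      LinearMap.mulRight_apply, proj_rmul, sub_eq_zero]
    change A.projR (a * A.incl y) = _
    suffices h : A.projR ∘ₗ LinearMap.mulRight K (A.incl y) ∘ₗ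
          (A.iso.toLinearEquiv.symm : SymmetricAlgebra K A.R →ₗ[K] A.H) =
        (Coalgebra.counit (R := K)).smulRight y + A.M11.flip y ∘ₗ proj K A.R by
      have h2 := LinearMap.congr_fun h (A.iso a)
      simp only [LinearMap.comp_apply, LinearEquiv.coe_coe, h1] at h2
      exact h2
    refine linearMap_ext_component fun n s hs => ?_
    obtain ⟨a, rfl⟩ : ∃ a, A.iso a = s := A.iso.toLinearEquiv.surjective s
    have h1 : (A.iso.toLinearEquiv.symm (A.iso a)) = a := A.iso.toLinearEquiv.symm_apply_apply a
    simp only [LinearMap.comp_apply, LinearEquiv.coe_coe, h1, LinearMap.add_apply,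
      LinearMap.smulRight_apply, LinearMap.flip_apply, LinearMap.mulRight_apply]
    match n, hs with
    | 0, hs =>
      obtain ⟨r, hr⟩ := mem_component_zero.1 hs
      have ha : a = r • 1 := by
        apply A.iso_injective
        rw [map_smul, A.iso_one, ← hr, Algebra.algebraMap_eq_smul_one]
      rw [proj_component zero_ne_one hs, ha]
      simp [A.iso_one, projR_apply, iso_incl]
    | 1, hs =>
      obtain ⟨x, hx⟩ := mem_component_one.1 hs
      have ha : a = A.incl x := A.iso_injective (by rw [← hx, iso_incl])
      rw [← hx, proj_ι, ha, counit_ι, zero_smul, zero_add]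
      rfl
    | n + 2, hs =>
      -- Right-sidedness enters only here, and only for `q = 2`.
      have hmem : a ∈ A.filtration 2 :=
        Submodule.mem_iSup_of_mem (n + 2)
          (Submodule.mem_iSup_of_mem (Nat.le_add_left 2 n) (A.mem_graded.2 hs))
      rw [A.projR_of_mem_filtration (hA 2 a hmem _), proj_component (by lia) hs,
        counit_component (by lia) hs]
      simp
  have h2 := LinearMap.congr_fun (sub_eq_zero.1 h0) (A.iso a)
  have h1 : (A.iso.toLinearEquiv.symm (A.iso a)) = a := A.iso.toLinearEquiv.symm_apply_apply a
  simp only [LinearMap.comp_apply, LinearEquiv.coe_coe, h1] at h2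
  exact h2

theorem IsRightSided.projR_mul_incl (hA : IsRightSided K A) (a : A.H) (y : A.R) :
    A.projR (a * A.incl y) = Coalgebra.counit (R := K) a • y + A.M11 (A.projR a) y := by
  rw [projR_apply, hA.iso_mul_incl, proj_rmul, counit_iso, projR_apply]

/-- In `x * y = xy + M₁₁(x, y)` the polynomial term `xy` is symmetric and cancels in the commutator.
-/
theorem IsRightSided.lie_incl (hA : IsRightSided K A) (x y : A.R) :
    ⁅A.incl x, A.incl y⁆ = A.incl (A.M11 x y - A.M11 y x) := by
  apply A.iso_injective
  rw [Ring.lie_def, map_sub, hA.iso_mul_incl, hA.iso_mul_incl, iso_incl, iso_incl, iso_incl,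
    rmul_ι, rmul_ι, map_sub, mul_comm (ι K A.R y)]
  abel

/-- Project `x * [y, z]` to `R`. By associativity this is `M₁₁(M₁₁(x, y), z) - M₁₁(M₁₁(x, z), y)`;
since `[y, z]` lies in `R` by `lie_incl`, it is also `M₁₁(x, M₁₁(y, z) - M₁₁(z, y))`. -/
theorem IsRightSided.M11_preLie (hA : IsRightSided K A) (x y z : A.R) :
    A.M11 (A.M11 x y) z - A.M11 x (A.M11 y z) = A.M11 (A.M11 x z) y - A.M11 x (A.M11 z y) := by
  have hcounit : ∀ x, Coalgebra.counit (R := K) (A.incl x) = 0 := fun x => by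
    rw [← counit_iso, iso_incl, counit_ι]
  have h : ∀ y z, A.projR (A.incl x * (A.incl y * A.incl z)) = A.M11 (A.M11 x y) z := fun y z => by
    rw [← mul_assoc, hA.projR_mul_incl, Bialgebra.counit_mul, hcounit, zero_mul, zero_smul,
      zero_add]
    rfl
  have h2 := congrArg (fun a => A.projR (A.incl x * a)) (hA.lie_incl y z)
  simp only [Ring.lie_def, mul_sub, map_sub, h] at h2
  change _ = A.M11 x (A.M11 y z) - A.M11 x (A.M11 z y) at h2
  rw [sub_eq_sub_iff_add_eq_add] at h2 ⊢
  rw [h2, add_comm]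

theorem IsRightSided.comul_eq_iff {a : A.H} :
    Coalgebra.comul (R := K) a = a ⊗ₜ[K] 1 + 1 ⊗ₜ[K] a ↔ ∃ x : A.R, A.incl x = a := by
  rw [comul_eq_iff_iso, SymCoalg.comul_eq_iff]
  exact exists_congr fun x => by rw [← iso_incl, A.iso_injective.eq_iff]

/-- A linear map which preserves the operations `M₁₁` is a morphism of right-sided combinatorial
Hopf algebras. -/
theorem IsRightSided.isHopf_of_map_M11 {B : CofreeCocommCHA.{u, v} K} (hA : IsRightSided K A)
    (hB : IsRightSided K B) (φ : A.R →ₗ[K] B.R)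
    (hφ : ∀ x y, φ (A.M11 x y) = B.M11 (φ x) (φ y)) :
    ∃ F : A.H →ₐc[K] B.H, ∀ a : A.H, B.iso (F a) = SymCoalg.map φ (A.iso a) := by
  let F : A.H →ₗc[K] B.H :=
    (B.iso.symm : SymmetricAlgebra K B.R →ₗc[K] B.H).comp
      (((SymCoalg.map φ : SymmetricAlgebra K A.R →ₐc[K] SymmetricAlgebra K B.R) :
        SymmetricAlgebra K A.R →ₗc[K] SymmetricAlgebra K B.R).comp
        (A.iso : A.H →ₗc[K] SymmetricAlgebra K A.R))
  have hF : ∀ a, B.iso (F a) = SymCoalg.map φ (A.iso a) := fun a =>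
    B.iso.toLinearEquiv.apply_symm_apply _
  have hF1 : F 1 = 1 := B.iso_injective (by rw [hF, iso_one, iso_one, map_one])
  have hincl : ∀ x, F (A.incl x) = B.incl (φ x) := fun x =>
    B.iso_injective (by rw [hF, iso_incl, iso_incl, map_ι])
  -- `F` is a coalgebra map by construction. It intertwines the operators `rmul`, so it respects
  -- right multiplication by elements of `R`.
  have hmul_incl : ∀ a x, F (a * A.incl x) = F a * F (A.incl x) := fun a x =>
    B.iso_injective (by
      rw [hF, hincl, hB.iso_mul_incl, hA.iso_mul_incl, hF, map_rmul φ A.M11 B.M11 hφ])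
  -- The right factors on which `F` is multiplicative contain `1` and are stable under `rmul`, so
  -- they fill `S(R)`.
  let N : Submodule K (SymmetricAlgebra K A.R) :=
    { carrier := {s | ∀ c, F (c * A.iso.symm s) = F c * F (A.iso.symm s)}
      zero_mem' := fun c => by simp
      add_mem' := fun {s t} hs ht c => by
        simp only [Set.mem_ofPred_eq] at hs ht
        rw [map_add, mul_add, map_add, map_add, mul_add, hs, ht]
      smul_mem' := fun r s hs c => by
        simp only [Set.mem_ofPred_eq] at hs
        rw [map_smul, mul_smul_comm, map_smul, map_smul, mul_smul_comm, hs] }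
  have hsymm : ∀ a, A.iso.symm (A.iso a) = a := A.iso.toLinearEquiv.symm_apply_apply
  have hN : N = ⊤ := by
    refine eq_top_of_rmul_mem A.M11 (fun c => ?_) (fun y s hs c => ?_)
    · rw [← A.iso_one, hsymm, mul_one, hF1, mul_one]
    · obtain ⟨a, rfl⟩ : ∃ a, A.iso a = s := A.iso.toLinearEquiv.surjective s
      have hs' := hs c
      rw [hsymm] at hs'
      rw [← hA.iso_mul_incl, hsymm, ← mul_assoc, hmul_incl, hmul_incl, hs', mul_assoc]
  have hmul : ∀ a b, F (a * b) = F a * F b := fun a b => by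
    have h : A.iso b ∈ N := hN ▸ Submodule.mem_top
    have h2 := h a
    rwa [hsymm] at h2
  exact ⟨{ F with map_one' := hF1, map_mul' := hmul }, hF⟩

end CofreeCocommCHA

-- The Hopf algebra structure of the enveloping algebra

attribute [local instance] LieRing.ofAssociativeRing

namespace UniversalEnvelopingAlgebra

variable {K : Type*} [Field K] {L : Type*} [LieRing L] [LieAlgebra K L]

theorem induction_ι {p : UniversalEnvelopingAlgebra K L → Prop}
    (algebraMap : ∀ r, p (algebraMap K _ r)) (ι : ∀ x, p (ι K x))
    (mul : ∀ a b, p a → p b → p (a * b)) (add : ∀ a b, p a → p b → p (a + b))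
    (a : UniversalEnvelopingAlgebra K L) : p a := by
  obtain ⟨a, rfl⟩ : ∃ t, mkAlgHom K L t = a := RingCon.mkₐ_surjective _ a
  induction a using TensorAlgebra.induction with
  | algebraMap r => rw [AlgHom.commutes]; exact algebraMap r
  | ι x => exact ι x
  | mul x y hx hy => rw [map_mul]; exact mul _ _ hx hy
  | add x y hx hy => rw [map_add]; exact add _ _ hx hy

theorem eq_top_of_mul_ι_mem {N : Submodule K (UniversalEnvelopingAlgebra K L)} (h1 : 1 ∈ N)
    (hN : ∀ a ∈ N, ∀ x, a * ι K x ∈ N) : N = ⊤ := by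
  refine Submodule.eq_top_iff'.2 fun a => ?_
  suffices h : ∀ b ∈ N, b * a ∈ N by simpa using h 1 h1
  induction a using induction_ι with
  | algebraMap r =>
    intro b hb
    rw [Algebra.algebraMap_eq_smul_one, mul_smul_comm, mul_one]
    exact N.smul_mem r hb
  | ι x => exact fun b hb => hN b hb x
  | mul a c ha hc => exact fun b hb => by rw [← mul_assoc]; exact hc _ (ha b hb)
  | add a c ha hc => exact fun b hb => by rw [mul_add]; exact add_mem (ha b hb) (hc b hb)

theorem eq_top_of_ι_mul_mem {N : Submodule K (UniversalEnvelopingAlgebra K L)} (h1 : 1 ∈ N)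
    (hN : ∀ a ∈ N, ∀ x, ι K x * a ∈ N) : N = ⊤ := by
  refine Submodule.eq_top_iff'.2 fun a => ?_
  suffices h : ∀ b ∈ N, a * b ∈ N by simpa using h 1 h1
  induction a using induction_ι with
  | algebraMap r =>
    intro b hb
    rw [Algebra.algebraMap_eq_smul_one, smul_mul_assoc, one_mul]
    exact N.smul_mem r hb
  | ι x => exact fun b hb => hN b hb x
  | mul a c ha hc => exact fun b hb => by rw [mul_assoc]; exact ha _ (hc b hb)
  | add a c ha hc => exact fun b hb => by rw [add_mul]; exact add_mem (ha b hb) (hc b hb)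

variable (K L) in
/-- The coproduct of the universal enveloping algebra, for which the elements of `L` are
primitive. -/
def comulHom : UniversalEnvelopingAlgebra K L →ₐ[K]
    UniversalEnvelopingAlgebra K L ⊗[K] UniversalEnvelopingAlgebra K L :=
  lift K
    { ((TensorProduct.mk K _ _).flip 1 + TensorProduct.mk K _ _ 1) ∘ₗ
        (ι K : L →ₗ⁅K⁆ UniversalEnvelopingAlgebra K L).toLinearMap with
      map_lie' := by
        intro x y
        change ι K ⁅x, y⁆ ⊗ₜ[K] 1 + 1 ⊗ₜ[K] ι K ⁅x, y⁆ =
          ⁅ι K x ⊗ₜ[K] 1 + 1 ⊗ₜ[K] ι K x, ι K y ⊗ₜ[K] 1 + 1 ⊗ₜ[K] ι K y⁆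
        simp only [LieHom.map_lie, Ring.lie_def, mul_add, add_mul,
          Algebra.TensorProduct.tmul_mul_tmul, one_mul, mul_one, TensorProduct.sub_tmul,
          TensorProduct.tmul_sub]
        abel }

theorem comulHom_ι (x : L) : comulHom K L (ι K x) = ι K x ⊗ₜ[K] 1 + 1 ⊗ₜ[K] ι K x :=
  lift_ι_apply K _ x

variable (K L) in
/-- The counit of the universal enveloping algebra. -/
def counitHom : UniversalEnvelopingAlgebra K L →ₐ[K] K :=
  lift K
    { (0 : L →ₗ[K] K) with
      map_lie' := by
        intro x y
        change (0 : K) = ⁅(0 : K), (0 : K)⁆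
        simp }

theorem counitHom_ι (x : L) : counitHom K L (ι K x) = 0 :=
  lift_ι_apply K _ x

theorem algHom_ext_ι {A : Type*} [Ring A] [Algebra K A]
    {f g : UniversalEnvelopingAlgebra K L →ₐ[K] A} (h : ∀ x, f (ι K x) = g (ι K x)) : f = g :=
  hom_ext K (LieHom.ext h)

instance : Bialgebra K (UniversalEnvelopingAlgebra K L) :=
  .ofAlgHom (comulHom K L) (counitHom K L)
    (algHom_ext_ι fun x => by
      simp [comulHom_ι, Algebra.TensorProduct.one_def, TensorProduct.add_tmul,
        TensorProduct.tmul_add, -ι_apply]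
      abel)
    (algHom_ext_ι fun x => by simp [comulHom_ι, counitHom_ι, -ι_apply])
    (algHom_ext_ι fun x => by simp [comulHom_ι, counitHom_ι, -ι_apply])

theorem comul_ι (x : L) :
    Coalgebra.comul (R := K) (ι K x) = ι K x ⊗ₜ[K] 1 + 1 ⊗ₜ[K] ι K x :=
  comulHom_ι x

theorem counit_ι (x : L) : Coalgebra.counit (R := K) (ι K x) = 0 :=
  counitHom_ι x

variable (K L) in
/-- The antipode of the universal enveloping algebra, as a map to the opposite algebra. -/
def antipodeHom : UniversalEnvelopingAlgebra K L →ₐ[K] (UniversalEnvelopingAlgebra K L)ᵐᵒᵖ :=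
  lift K
    { -((MulOpposite.opLinearEquiv K).toLinearMap ∘ₗ
        (ι K : L →ₗ⁅K⁆ UniversalEnvelopingAlgebra K L).toLinearMap) with
      map_lie' := by
        intro x y
        change -MulOpposite.op (ι K ⁅x, y⁆) = ⁅-MulOpposite.op (ι K x), -MulOpposite.op (ι K y)⁆
        simp only [LieHom.map_lie, Ring.lie_def, neg_mul_neg, ← MulOpposite.op_mul,
          ← MulOpposite.op_sub, ← MulOpposite.op_neg, neg_sub] }

theorem antipodeHom_ι (x : L) : antipodeHom K L (ι K x) = -MulOpposite.op (ι K x) :=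
  lift_ι_apply K _ x

instance : HopfAlgebra K (UniversalEnvelopingAlgebra K L) where
  antipode := (MulOpposite.opLinearEquiv K).symm.toLinearMap ∘ₗ (antipodeHom K L).toLinearMap
  mul_antipode_rTensor_comul := by
    set S : UniversalEnvelopingAlgebra K L →ₗ[K] UniversalEnvelopingAlgebra K L :=
      (MulOpposite.opLinearEquiv K).symm.toLinearMap ∘ₗ (antipodeHom K L).toLinearMap with hS
    have hSι : ∀ a x, S (a * ι K x) = -(ι K x * S a) := fun a x => by
      simp [hS, antipodeHom_ι, -ι_apply]
    have hS1 : S 1 = 1 := by simp [hS]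
    rw [← LinearMap.eqLocus_eq_top]
    refine eq_top_of_mul_ι_mem ?_ fun a ha x => ?_
    · simp [Algebra.TensorProduct.one_def, hS1]
    · simp only [LinearMap.mem_eqLocus, LinearMap.comp_apply] at ha ⊢
      rw [Bialgebra.counit_mul, counit_ι, mul_zero, map_zero, Bialgebra.comul_mul, comul_ι]
      -- Multiplying by `Δ x` turns `m (S ⊗ 1) t` into its commutator with `x`, which vanishes when
      -- this element is a scalar.
      have h : ∀ t : UniversalEnvelopingAlgebra K L ⊗[K] UniversalEnvelopingAlgebra K L,
          LinearMap.mul' K _ (S.rTensor _ (t * (ι K x ⊗ₜ[K] 1 + 1 ⊗ₜ[K] ι K x))) =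
          LinearMap.mul' K _ (S.rTensor _ t) * ι K x -
            ι K x * LinearMap.mul' K _ (S.rTensor _ t) := by
        intro t
        induction t with
        | zero => simp
        | tmul b c => simp [mul_add, hSι, mul_assoc, -ι_apply]; abel
        | add s t hs ht =>
          rw [add_mul, map_add, map_add, hs, ht, map_add, map_add, add_mul, mul_add]
          abel
      rw [h, ha, Algebra.linearMap_apply, Algebra.commutes, sub_self]
  mul_antipode_lTensor_comul := by
    set S : UniversalEnvelopingAlgebra K L →ₗ[K] UniversalEnvelopingAlgebra K L :=
      (MulOpposite.opLinearEquiv K).symm.toLinearMap ∘ₗ (antipodeHom K L).toLinearMap with hS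
    have hSι : ∀ a x, S (a * ι K x) = -(ι K x * S a) := fun a x => by
      simp [hS, antipodeHom_ι, -ι_apply]
    have hS1 : S 1 = 1 := by simp [hS]
    rw [← LinearMap.eqLocus_eq_top]
    refine eq_top_of_mul_ι_mem ?_ fun a ha x => ?_
    · simp [Algebra.TensorProduct.one_def, hS1]
    · simp only [LinearMap.mem_eqLocus, LinearMap.comp_apply] at ha ⊢
      rw [Bialgebra.counit_mul, counit_ι, mul_zero, map_zero, Bialgebra.comul_mul, comul_ι]
      -- On this side the two terms `b x S(c)` and `b S(c x) = -b x S(c)` cancel for every `t`.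
      have h : ∀ t : UniversalEnvelopingAlgebra K L ⊗[K] UniversalEnvelopingAlgebra K L,
          LinearMap.mul' K _ (S.lTensor _ (t * (ι K x ⊗ₜ[K] 1 + 1 ⊗ₜ[K] ι K x))) = 0 := by
        intro t
        induction t with
        | zero => simp
        | tmul b c => simp [mul_add, hSι, mul_assoc, -ι_apply]
        | add s t hs ht => rw [add_mul, map_add, map_add, hs, ht, add_zero]
      exact h _

end UniversalEnvelopingAlgebra

/-! ### Commutators and linearity of derivations; filtration by word length -/

namespace SymCoalg

open SymmetricAlgebra

variable {K : Type u} [Field K]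

theorem der_der_sub {V : Type v} [AddCommGroup V] [Module K V] (δ δ' δ'' : V →ₗ[K] V)
    (h : ∀ x, δ' (δ x) - δ (δ' x) = δ'' x) (a : SymmetricAlgebra K V) :
    der δ' (der δ a) - der δ (der δ' a) = der δ'' a := by
  induction a using SymmetricAlgebra.induction with
  | algebraMap r => simp
  | ι x => simp only [der_ι, ← h, map_sub]
  | mul a b ha hb =>
    simp only [der_mul, map_add, ← ha, ← hb]
    ring
  | add a b ha hb =>
    simp only [map_add, ← ha, ← hb]
    ring

theorem der_add {V : Type v} [AddCommGroup V] [Module K V] (δ δ' : V →ₗ[K] V)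
    (a : SymmetricAlgebra K V) : der (δ + δ') a = der δ a + der δ' a := by
  induction a using SymmetricAlgebra.induction with
  | algebraMap r => simp
  | ι x => simp
  | mul a b ha hb => simp only [der_mul, ha, hb]; ring
  | add a b ha hb => rw [map_add, map_add, map_add, ha, hb]; ring

theorem der_smul {V : Type v} [AddCommGroup V] [Module K V] (r : K) (δ : V →ₗ[K] V)
    (a : SymmetricAlgebra K V) : der (r • δ) a = r • der δ a := by
  induction a using SymmetricAlgebra.induction with
  | algebraMap r => simp
  | ι x => simp
  | mul a b ha hb => simp only [der_mul, ha, hb, smul_add, mul_smul_comm]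
  | add a b ha hb => simp only [map_add, ha, hb, smul_add]

/-! ### Spans of words -/

section Words

variable {A κ : Type*} [Ring A] [Algebra K A]

variable (K) in
/-- The span of the products of fewer than `n` elements of a family. -/
def wordSpan (g : κ → A) (n : ℕ) : Submodule K A :=
  Submodule.span K {a | ∃ l : List κ, l.length < n ∧ (l.map g).prod = a}

theorem word_mem (g : κ → A) {l : List κ} {n : ℕ} (h : l.length < n) :
    (l.map g).prod ∈ wordSpan K g n :=
  Submodule.subset_span ⟨l, h, rfl⟩

theorem wordSpan_le {g : κ → A} {n : ℕ} {N : Submodule K A}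
    (h : ∀ l : List κ, l.length < n → (l.map g).prod ∈ N) : wordSpan K g n ≤ N :=
  Submodule.span_le.2 (by rintro _ ⟨l, hl, rfl⟩; exact h l hl)

theorem wordSpan_mono (g : κ → A) {m n : ℕ} (h : m ≤ n) : wordSpan K g m ≤ wordSpan K g n :=
  wordSpan_le fun _ hl => word_mem g (hl.trans_le h)

theorem wordSpan_zero (g : κ → A) : wordSpan K g 0 = ⊥ :=
  le_bot_iff.1 (wordSpan_le fun _ hl => absurd hl (Nat.not_lt_zero _))

theorem mul_mem_wordSpan {g : κ → A} {n : ℕ} {a c : A} (ha : a ∈ wordSpan K g n)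
    (hc : c ∈ Submodule.span K (Set.range g)) : c * a ∈ wordSpan K g (n + 1) := by
  suffices h : wordSpan K g n ≤ (wordSpan K g (n + 1)).comap (LinearMap.mulLeft K c) from h ha
  refine wordSpan_le fun l hl => ?_
  suffices h : Submodule.span K (Set.range g) ≤
      (wordSpan K g (n + 1)).comap (LinearMap.mulRight K (l.map g).prod) from h hc
  refine Submodule.span_le.2 ?_
  rintro _ ⟨i, rfl⟩
  exact word_mem g (l := i :: l) (by simpa using hl)

theorem map_mem_span_range {L : Type*} [AddCommGroup L] [Module K L] (b : Module.Basis κ K L)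
    (j : L →ₗ[K] A) (x : L) : j x ∈ Submodule.span K (Set.range fun i => j (b i)) := by
  have h := Submodule.mem_map_of_mem (f := j) (b.mem_span x)
  rwa [Submodule.map_span, ← Set.range_comp] at h

end Words

section SymmetricWords

variable {V : Type v} [AddCommGroup V] [Module K V] {κ : Type*} (b : Module.Basis κ K V)

theorem der_word_mem (δ : V →ₗ[K] V) (l : List κ) :
    der δ (l.map fun i => ι K V (b i)).prod ∈
      wordSpan K (fun i => ι K V (b i)) (l.length + 1) := by
  induction l with
  | nil => simp
  | cons i l ih =>
    rw [List.map_cons, List.prod_cons, der_mul, der_ι, mul_comm _ (ι K V (δ (b i)))]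
    exact add_mem (mul_mem_wordSpan ih (map_mem_span_range b (ι K V) _))
      (mul_mem_wordSpan (word_mem _ (Nat.lt_succ_self _)) (map_mem_span_range b (ι K V) _))

theorem rmul_mem_wordSpan (μ : V →ₗ[K] V →ₗ[K] V) (y : V) {n : ℕ} {a : SymmetricAlgebra K V}
    (ha : a ∈ wordSpan K (fun i => ι K V (b i)) n) :
    rmul μ y a ∈ wordSpan K (fun i => ι K V (b i)) (n + 1) := by
  suffices h : wordSpan K (fun i => ι K V (b i)) n ≤
      (wordSpan K (fun i => ι K V (b i)) (n + 1)).comap (rmul μ y) from h ha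
  refine wordSpan_le fun l hl => ?_
  rw [Submodule.mem_comap, rmul_apply, mul_comm]
  exact add_mem (mul_mem_wordSpan (word_mem _ hl) (map_mem_span_range b (ι K V) _))
    (wordSpan_mono _ (by lia) (der_word_mem b _ l))

theorem symmetricAlgebra_basis_apply (s : κ →₀ ℕ) :
    b.symmetricAlgebra s = (s.toMultiset.map fun i => ι K V (b i)).prod := by
  have h : b.symmetricAlgebra s = (equivMvPolynomial b).symm (MvPolynomial.monomial s 1) := by
    simp [Module.Basis.symmetricAlgebra]
  rw [h, MvPolynomial.monomial_eq, map_mul, map_finsuppProd, Finsupp.toMultiset_map,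
    Finsupp.prod_toMultiset]
  simp [Finsupp.prod_mapDomain_index, pow_add]

/-- A linear map from the symmetric algebra which takes every monomial in the elements of a basis
to a product, in some order, of the images of these elements. -/
def ofMonomials {A : Type*} [Ring A] [Algebra K A] (g : κ → A) : SymmetricAlgebra K V →ₗ[K] A :=
  b.symmetricAlgebra.constr K fun s => (s.toMultiset.toList.map g).prod

/-- A monomial forgets the order of its letters, so the lifted word is known only up to a
permutation. -/
theorem exists_perm_ofMonomials {A : Type*} [Ring A] [Algebra K A] (g : κ → A) (l : List κ) :
    ∃ l', l.Perm l' ∧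
      ofMonomials b g (l.map fun i => ι K V (b i)).prod = (l'.map g).prod := by
  classical
  refine ⟨(l : Multiset κ).toList, (Multiset.coe_eq_coe.1 (Multiset.coe_toList _)).symm, ?_⟩
  have h : (l.map fun i => ι K V (b i)).prod =
      b.symmetricAlgebra (Multiset.toFinsupp (l : Multiset κ)) := by
    rw [symmetricAlgebra_basis_apply, Multiset.toFinsupp_toMultiset, Multiset.map_coe,
      Multiset.prod_coe]
  rw [h, ofMonomials, Module.Basis.constr_basis, Multiset.toFinsupp_toMultiset]

theorem ofMonomials_mem {A : Type*} [Ring A] [Algebra K A] (g : κ → A) {n : ℕ}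
    {a : SymmetricAlgebra K V} (ha : a ∈ wordSpan K (fun i => ι K V (b i)) n) :
    ofMonomials b g a ∈ wordSpan K g n := by
  suffices h : wordSpan K (fun i => ι K V (b i)) n ≤
      (wordSpan K g n).comap (ofMonomials b g) from h ha
  refine wordSpan_le fun l hl => ?_
  obtain ⟨l', hl', h⟩ := exists_perm_ofMonomials b g l
  rw [Submodule.mem_comap, h]
  exact word_mem g (hl'.length_eq ▸ hl)

end SymmetricWords

end SymCoalg

/-! ### The action of the enveloping algebra on `S(L)` and the isomorphism `U(L) ≅ S(L)` -/

namespace UniversalEnvelopingAlgebra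

open SymCoalg

section Words

variable {K : Type u} [Field K] {L : Type*} [LieRing L] [LieAlgebra K L] {κ : Type*}
  (b : Module.Basis κ K L)

theorem ι_mem_span_range (x : L) : ι K x ∈ Submodule.span K (Set.range fun i => ι K (b i)) :=
  map_mem_span_range b (ι K : L →ₗ⁅K⁆ UniversalEnvelopingAlgebra K L).toLinearMap x

/-- An adjacent transposition costs a bracket, which is one element of `L` replacing two letters. -/
theorem word_sub_word_mem {l l' : List κ} (h : l.Perm l') :
    (l.map fun i => ι K (b i)).prod - (l'.map fun i => ι K (b i)).prod ∈
      wordSpan K (fun i => ι K (b i)) l.length := by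
  induction h with
  | nil => simp
  | cons i _ ih =>
    rw [List.map_cons, List.map_cons, List.prod_cons, List.prod_cons, ← mul_sub]
    exact mul_mem_wordSpan ih (ι_mem_span_range b _)
  | swap i j l =>
    have h : ((j :: i :: l).map fun i => ι K (b i)).prod -
        ((i :: j :: l).map fun i => ι K (b i)).prod =
        ι K ⁅b j, b i⁆ * (l.map fun i => ι K (b i)).prod := by
      rw [LieHom.map_lie, Ring.lie_def]
      simp only [List.map_cons, List.prod_cons, sub_mul, mul_assoc]
    rw [h]
    exact mul_mem_wordSpan (word_mem _ (Nat.lt_succ_self _)) (ι_mem_span_range b _)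
  | trans h1 _ ih1 ih2 =>
    rw [← h1.length_eq] at ih2
    simpa using add_mem ih1 ih2

theorem exists_mem_wordSpan (a : UniversalEnvelopingAlgebra K L) :
    ∃ n, a ∈ wordSpan K (fun i => ι K (b i)) n := by
  have hdir : Directed (· ≤ ·) (wordSpan K fun i => ι K (b i)) :=
    Monotone.directed_le fun _ _ => wordSpan_mono _
  rw [← Submodule.mem_iSup_of_directed _ hdir, eq_top_of_ι_mul_mem
    (N := ⨆ n, wordSpan K (fun i => ι K (b i)) n)]
  · trivial
  · exact Submodule.mem_iSup_of_mem 1 (word_mem _ (l := []) Nat.zero_lt_one)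
  · intro c hc x
    obtain ⟨n, hn⟩ := (Submodule.mem_iSup_of_directed _ hdir).1 hc
    exact Submodule.mem_iSup_of_mem (n + 1) (mul_mem_wordSpan hn (ι_mem_span_range b x))

end Words

variable {K : Type u} [Field K] {L : Type v} [RightPreLieRing L] [RightPreLieAlgebra K L]

/-- The pre-Lie identity says that right multiplications of `L` commute up to right multiplication
by `[x, y]`; `der_der_sub` extends this to derivations, and the cross terms contribute `a · (xy -
yx)`. The order of the composites makes this a right action, hence the opposite algebra in
`symAction`. -/
theorem rmul_rmul_sub (x y : L) (a : SymmetricAlgebra K L) :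
    rmul (LinearMap.mul K L) y (rmul (LinearMap.mul K L) x a) -
      rmul (LinearMap.mul K L) x (rmul (LinearMap.mul K L) y a) =
      rmul (LinearMap.mul K L) ⁅x, y⁆ a := by
  have hder := der_der_sub ((LinearMap.mul K L).flip x) ((LinearMap.mul K L).flip y)
    ((LinearMap.mul K L).flip ⁅x, y⁆) (fun z => by
      have h := RightPreLieRing.assoc_symm z x y
      simp only [associator_apply] at h
      change z * x * y - z * y * x = z * ⁅x, y⁆
      rw [Ring.lie_def, mul_sub]
      rw [sub_eq_sub_iff_add_eq_add] at h ⊢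
      rw [h, add_comm]) a
  have hι : SymmetricAlgebra.ι K L ⁅x, y⁆ =
      SymmetricAlgebra.ι K L (x * y) - SymmetricAlgebra.ι K L (y * x) := by
    rw [Ring.lie_def, map_sub]
  simp only [rmul_apply, map_add, der_mul, der_ι, ← hder, hι, LinearMap.flip_apply,
    LinearMap.mul_apply']
  ring

variable (K L) in
/-- The right action of the enveloping algebra of a pre-Lie algebra `L` on `S(L)`. -/
def symAction : UniversalEnvelopingAlgebra K L →ₐ[K] (Module.End K (SymmetricAlgebra K L))ᵐᵒᵖ :=
  lift K
    { toFun := fun x => MulOpposite.op (rmul (LinearMap.mul K L) x)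
      map_add' := fun x y => by
        rw [← MulOpposite.op_add]
        refine congrArg _ (LinearMap.ext fun a => ?_)
        rw [LinearMap.add_apply, rmul_apply, rmul_apply, rmul_apply, map_add, map_add, der_add]
        ring
      map_smul' := fun r x => by
        rw [RingHom.id_apply, ← MulOpposite.op_smul]
        refine congrArg _ (LinearMap.ext fun a => ?_)
        rw [LinearMap.smul_apply, rmul_apply, rmul_apply, map_smul, map_smul, der_smul,
          mul_smul_comm, smul_add]
      map_lie' := fun {x y} => by
        change MulOpposite.op (rmul (LinearMap.mul K L) ⁅x, y⁆) =
          MulOpposite.op (rmul (LinearMap.mul K L) y * rmul (LinearMap.mul K L) x -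
            rmul (LinearMap.mul K L) x * rmul (LinearMap.mul K L) y)
        exact congrArg _ (LinearMap.ext fun a => (rmul_rmul_sub x y a).symm) }

theorem symAction_ι (x : L) :
    symAction K L (ι K x) = MulOpposite.op (rmul (LinearMap.mul K L) x) :=
  lift_ι_apply K _ x

variable (K L) in
/-- The orbit map `u ↦ 1 · u` of the action of the enveloping algebra of `L` on `S(L)`. -/
def toSym : UniversalEnvelopingAlgebra K L →ₗ[K] SymmetricAlgebra K L :=
  LinearMap.applyₗ 1 ∘ₗ (MulOpposite.opLinearEquiv K).symm.toLinearMap ∘ₗ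
    (symAction K L).toLinearMap

theorem toSym_one : toSym K L 1 = 1 := by
  simp [toSym]

theorem toSym_mul_ι (a : UniversalEnvelopingAlgebra K L) (x : L) :
    toSym K L (a * ι K x) = rmul (LinearMap.mul K L) x (toSym K L a) := by
  change MulOpposite.unop (symAction K L (a * ι K x)) 1 = _
  rw [map_mul, symAction_ι]
  rfl

theorem toSym_ι (x : L) : toSym K L (ι K x) = SymmetricAlgebra.ι K L x := by
  rw [← one_mul (ι K x), toSym_mul_ι, toSym_one, rmul_one]

theorem toSym_surjective : Function.Surjective (toSym K L) := by
  rw [← LinearMap.range_eq_top]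
  refine eq_top_of_rmul_mem (LinearMap.mul K L) ⟨1, toSym_one⟩ ?_
  rintro y _ ⟨a, rfl⟩
  exact ⟨a * ι K y, toSym_mul_ι a y⟩

/-- Unitriangularity: each `rmul` is multiplication plus a derivation, and the derivation does not
lengthen words. -/
theorem toSym_word_sub_mem {κ : Type*} (b : Module.Basis κ K L) (l : List κ) :
    toSym K L (l.map fun i => ι K (b i)).prod - (l.map fun i => SymmetricAlgebra.ι K L (b i)).prod ∈
      wordSpan K (fun i => SymmetricAlgebra.ι K L (b i)) l.length := by
  induction l using List.reverseRecOn with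
  | nil => simp [toSym_one]
  | append_singleton l i ih =>
    simp only [List.map_append, List.prod_append, List.map_cons, List.map_nil, List.prod_singleton,
      toSym_mul_ι, List.length_append, List.length_singleton]
    have h := add_mem (rmul_mem_wordSpan b (LinearMap.mul K L) (b i) ih)
      (der_word_mem b ((LinearMap.mul K L).flip (b i)) l)
    rw [map_sub, rmul_apply _ _ (List.prod _)] at h
    convert h using 1
    ring

/-- `ofMonomials` inverts `toSym` up to shorter words, so an element of the kernel descends through
the filtration to `wordSpan 0`, which is zero. -/
theorem toSym_injective : Function.Injective (toSym K L) := by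
  let b := Module.Basis.ofVectorSpace K L
  have hsub : ∀ n, ∀ a ∈ wordSpan K (fun i => ι K (b i)) (n + 1),
      a - ofMonomials b (fun i => ι K (b i)) (toSym K L a) ∈
        wordSpan K (fun i => ι K (b i)) n := by
    intro n
    suffices h : wordSpan K (fun i => ι K (b i)) (n + 1) ≤
        (wordSpan K (fun i => ι K (b i)) n).comap
          (LinearMap.id - ofMonomials b (fun i => ι K (b i)) ∘ₗ toSym K L) from h
    refine wordSpan_le fun l hl => ?_
    obtain ⟨l', hl', h⟩ := exists_perm_ofMonomials b (fun i => ι K (b i)) l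
    have h1 := ofMonomials_mem b (fun i => ι K (b i)) (toSym_word_sub_mem b l)
    rw [map_sub, h] at h1
    have h2 := sub_mem (word_sub_word_mem b hl') h1
    refine wordSpan_mono _ (Nat.lt_succ_iff.1 hl) ?_
    rwa [sub_sub_sub_cancel_right] at h2
  have hzero : ∀ n, ∀ a ∈ wordSpan K (fun i => ι K (b i)) n, toSym K L a = 0 → a = 0 := by
    intro n
    induction n with
    | zero =>
      intro a ha _
      rwa [wordSpan_zero, Submodule.mem_bot] at ha
    | succ n ih =>
      intro a ha h
      have h1 := hsub n a ha
      rw [h, map_zero, sub_zero] at h1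
      exact ih a h1 h
  refine (injective_iff_map_eq_zero _).2 fun a h => ?_
  obtain ⟨n, hn⟩ := exists_mem_wordSpan b a
  exact hzero n a hn h

theorem counit_toSym (a : UniversalEnvelopingAlgebra K L) :
    Coalgebra.counit (R := K) (toSym K L a) = Coalgebra.counit (R := K) a := by
  suffices h : Coalgebra.counit (R := K) ∘ₗ toSym K L = Coalgebra.counit (R := K) from
    LinearMap.congr_fun h a
  rw [← LinearMap.eqLocus_eq_top]
  refine eq_top_of_mul_ι_mem ?_ fun a _ x => ?_
  · simp [toSym_one]
  · simp [toSym_mul_ι, counit_rmul, counit_ι, -ι_apply]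

/-- Both sides obey the same recursion under `a ↦ a x`: `x` is primitive in `U(L)` and `rmul` is a
coderivation. -/
theorem comul_toSym (a : UniversalEnvelopingAlgebra K L) :
    TensorProduct.map (toSym K L) (toSym K L) (Coalgebra.comul (R := K) a) =
      Coalgebra.comul (R := K) (toSym K L a) := by
  suffices h : TensorProduct.map (toSym K L) (toSym K L) ∘ₗ Coalgebra.comul (R := K) =
      Coalgebra.comul (R := K) ∘ₗ toSym K L from LinearMap.congr_fun h a
  rw [← LinearMap.eqLocus_eq_top]
  refine eq_top_of_mul_ι_mem ?_ fun a ha x => ?_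
  · simp [toSym_one, Algebra.TensorProduct.one_def]
  · simp only [LinearMap.mem_eqLocus, LinearMap.comp_apply] at ha ⊢
    rw [toSym_mul_ι, isCoderivation_rmul, ← ha, Bialgebra.comul_mul, comul_ι]
    generalize Coalgebra.comul (R := K) a = t
    induction t with
    | zero => simp
    | tmul b c => simp [mul_add, toSym_mul_ι, -ι_apply]
    | add s t hs ht =>
      simp only [add_mul, map_add] at hs ht ⊢
      rw [hs, ht]
      abel

variable (K L) in
/-- The enveloping algebra of a pre-Lie algebra `L` is isomorphic to `S(L)` as a coalgebra. -/
def symEquiv : UniversalEnvelopingAlgebra K L ≃ₗc[K] SymmetricAlgebra K L :=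
  .ofBijective (f := { toSym K L with
    counit_comp := LinearMap.ext counit_toSym
    map_comp_comul := LinearMap.ext comul_toSym }) ⟨toSym_injective, toSym_surjective⟩

theorem mul_mem_symFiltration (q : ℕ) {a : UniversalEnvelopingAlgebra K L}
    (ha : a ∈ ⨆ n : ℕ, ⨆ _ : q ≤ n, (component K L n).comap (toSym K L))
    (c : UniversalEnvelopingAlgebra K L) :
    a * c ∈ ⨆ n : ℕ, ⨆ _ : q ≤ n, (component K L n).comap (toSym K L) := by
  set N := ⨆ n : ℕ, ⨆ _ : q ≤ n, (component K L n).comap (toSym K L) with hN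
  have hmem : ∀ n, q ≤ n → ∀ b, toSym K L b ∈ component K L n → b ∈ N := fun n hn b hb =>
    Submodule.mem_iSup_of_mem n (Submodule.mem_iSup_of_mem hn hb)
  have hι : ∀ x : L, N ≤ N.comap (LinearMap.mulRight K (ι K x)) := by
    refine fun x => iSup₂_le fun n hn a ha => ?_
    -- `rmul` never lowers degree: its parts of degrees `n + 1` and `n` are pulled back separately
    -- to `U(L)`.
    obtain ⟨c, hc⟩ := toSym_surjective (toSym K L a * SymmetricAlgebra.ι K L x)
    obtain ⟨d, hd⟩ := toSym_surjective (der ((LinearMap.mul K L).flip x) (toSym K L a))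
    have h : a * ι K x = c + d :=
      toSym_injective (by rw [toSym_mul_ι, map_add, hc, hd, rmul_apply])
    rw [Submodule.mem_comap, LinearMap.mulRight_apply, h]
    refine add_mem (hmem (n + 1) (by lia) c ?_) (hmem n hn d ?_)
    · rw [hc]
      exact mul_mem_component ha (ι_mem_component x)
    · rw [hd]
      exact der_mem_component _ ha
  have htop : N.comap (LinearMap.mulLeft K a) = ⊤ := by
    refine eq_top_of_mul_ι_mem ?_ fun c hc x => ?_
    · rwa [Submodule.mem_comap, LinearMap.mulLeft_apply, mul_one]
    · rw [Submodule.mem_comap, LinearMap.mulLeft_apply] at hc ⊢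
      rw [← mul_assoc]
      exact hι x hc
  exact (htop ▸ Submodule.mem_top : c ∈ N.comap (LinearMap.mulLeft K a))

end UniversalEnvelopingAlgebra

namespace CofreeCocommCHA

open SymCoalg UniversalEnvelopingAlgebra

variable (K : Type u) [Field K] (L : Type v) [RightPreLieRing L] [RightPreLieAlgebra K L]

/-- The enveloping algebra of a pre-Lie algebra, as a combinatorial Hopf algebra. -/
def ofPreLie : CofreeCocommCHA.{u, v} K where
  R := L
  H := UniversalEnvelopingAlgebra K L
  iso := symEquiv K L

theorem ofPreLie_incl (x : L) : (ofPreLie K L).incl x = ι K x :=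
  (ofPreLie K L).iso_injective
    (((ofPreLie K L).iso_incl x).trans (toSym_ι x).symm)

theorem ofPreLie_M11 (x y : L) : (ofPreLie K L).M11 x y = x * y := by
  change (ofPreLie K L).projR ((ofPreLie K L).incl x * (ofPreLie K L).incl y) = x * y
  rw [ofPreLie_incl, ofPreLie_incl]
  change proj K L (toSym K L (ι K x * ι K y)) = x * y
  rw [toSym_mul_ι, toSym_ι, proj_rmul, SymmetricAlgebra.counit_ι, zero_smul, zero_add, proj_ι]
  rfl

theorem isRightSided_ofPreLie : IsRightSided K (ofPreLie K L) :=
  fun q _ ha c => mul_mem_symFiltration q ha c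

end CofreeCocommCHA

end

/-- Over a field `K` of characteristic zero: for a cofree-cocommutative right-sided combinatorial
Hopf algebra `H ≅ Sᶜ(R)` the operation `M₁₁` on `R` is pre-Lie, the resulting functor to the
category of pre-Lie algebras is an equivalence of categories, `R` is the space of primitive elements
of `H`, and the Lie bracket of primitive elements is the antisymmetrization of `M₁₁`. -/
theorem theorem5p1 (K : Type u) [Field K] [CharZero K] :
    ∃ h : (∀ A : RightSidedCHA.{u, v} K, ∀ x y z : A.obj.R,
        A.obj.M11 (A.obj.M11 x y) z - A.obj.M11 x (A.obj.M11 y z)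
          = A.obj.M11 (A.obj.M11 x z) y - A.obj.M11 x (A.obj.M11 z y)),
      (primFunctor.{u, v} K h).IsEquivalence ∧
      ∀ A : RightSidedCHA.{u, v} K,
        (∀ a : A.obj.H,
          Coalgebra.comul (R := K) a = a ⊗ₜ[K] 1 + 1 ⊗ₜ[K] a ↔ ∃ x : A.obj.R, A.obj.incl x = a) ∧
        ∀ x y : A.obj.R,
          ⁅A.obj.incl x, A.obj.incl y⁆ = A.obj.incl (A.obj.M11 x y - A.obj.M11 y x) := by
  refine ⟨fun A => A.property.M11_preLie, ?_, fun A =>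
    ⟨fun a => CofreeCocommCHA.IsRightSided.comul_eq_iff, A.property.lie_incl⟩⟩
  set F := primFunctor.{u, v} K fun A => A.property.M11_preLie
  have hfaithful : F.Faithful :=
    { map_injective := fun {A B f g} hfg => by
        apply ObjectProperty.hom_ext
        apply CofreeCocommCHA.Hom.ext
        ext x
        exact DFunLike.congr_fun (congrArg PreLieAlgCat.Hom.toNonUnitalAlgHom hfg) x }
  have hfull : F.Full :=
    { map_surjective := fun {A B} f => by
        let φ : A.obj.R →ₗ[K] B.obj.R :=
          { toFun := fun x => f.toNonUnitalAlgHom x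
            map_add' := f.toNonUnitalAlgHom.map_add'
            map_smul' := f.toNonUnitalAlgHom.map_smul' }
        exact ⟨ObjectProperty.homMk ⟨φ, A.property.isHopf_of_map_M11 B.property φ
          f.toNonUnitalAlgHom.map_mul'⟩, rfl⟩ }
  -- `U(L)` has underlying space `R = L` and `M₁₁` the product of `L`, so the identity map is the
  -- required isomorphism.
  have hsurj : F.EssSurj :=
    { mem_essImage := fun L => ⟨⟨CofreeCocommCHA.ofPreLie K L.carrier,
        CofreeCocommCHA.isRightSided_ofPreLie K L.carrier⟩, ⟨
        { hom := ⟨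
            { toFun := fun x => x
              map_smul' := fun _ _ => rfl
              map_zero' := rfl
              map_add' := fun _ _ => rfl
              map_mul' := CofreeCocommCHA.ofPreLie_M11 K L.carrier }⟩
          inv := ⟨
            { toFun := fun x => x
              map_smul' := fun _ _ => rfl
              map_zero' := rfl
              map_add' := fun _ _ => rfl
              map_mul' := fun x y => (CofreeCocommCHA.ofPreLie_M11 K L.carrier x y).symm }⟩
          hom_inv_id := rfl
          inv_hom_id := rfl }⟩⟩ }
  exact { }
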